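/- Let $\pi:Y\to X$ be a fibred manifold, i.e. a smooth ($C^\infty$) surjective submersion of Hausdorff second-countable manifolds, $\dim X=n$, $\dim Y=n+m$, with fibred coordinates $(x^\lambda,y^i)$, $\omega=dx^1\wedge\dots\wedge dx^n$, $\omega_\lambda=\partial_\lambda\rfloor\omega$. Let $J^1Y$ be its first order jet manifold (coordinates $y^i_\lambda$) and $\Pi=\Lambda^nT^*X\otimes_Y TX\otimes_Y V^*Y$ its Legendre manifold (coordinates $p^\lambda_i$). A connection on $Y$ is a global smooth section $\Gamma$ of $J^1Y\to Y$. For a Lagrangian density $L=\mathcal L\omega$ on $J^1Y$ the Legendre morphism $\widehat L:J^1Y\to\Pi$ is $p^\lambda_i\circ\widehat L=\partial^\lambda_i\mathcal L$. A Hamiltonian form is a form on $\Pi$ given in all fibred coordinates by $H=p^\lambda_i\,dy^i\wedge\omega_\lambda-\mathcal H\omega$ with $\mathcal H$ smooth; its momentum morphism $\widehat H:\Pi\to J^1Y$ is $y^i_\lambda\circ\widehat H=\partial^i_\lambda\mathcal H$, and its Hamilton equations for sections $r$ of $\Pi\to X$ are $$\text{(a)}\ \ \partial_\lambda r^i=\partial^i_\lambda\mathcal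 H,\qquad \text{(b)}\ \ \partial_\lambda r^\lambda_i=-\partial_i\mathcal H .$$ For a momentum morphism $\Phi:\Pi\to J^1Y$ over $Y$ put $H_\Phi=p^\lambda_i\,dy^i\wedge\omega_\lambda-p^\lambda_i\Phi^i_\lambda\omega$; a connection $\Gamma$ is regarded as the momentum morphism $\Pi\to Y\xrightarrow{\Gamma}J^1Y$. $H$ is associated with $L$ if $\widehat L\circ\widehat H=\mathrm{Id}$ on $Q=\widehat L(J^1Y)$ and $H=H_{\widehat H}+L\circ\widehat H$. $L$ is semiregular if $\widehat L^{-1}(q)$ is a connected submanifold of $J^1Y$ for every $q\in Q$. A family of Hamiltonian forms associated with a semiregular $L$ is complete if for every section $\overline s$ of $J^1Y\to X$ that solves the first order Euler-Lagrange equations $$\partial_\lambda\overline s^i=\overline s^i_\lambda,\qquad \partial_i\mathcal L-(\partial_\lambda+\overline s^j_\lambda\partial_j+\partial_\lambda\overline s^j_\mu\partial^\mu_j)\partial^\lambda_i\mathcal L=0$$ there are a form $H$ in the family and a solution $r$ of its Hamilton equations (a), (b) with $r=\widehat L\circ\overline s$, $\overline s=\widehat H\circ r$ and $\overline s=J^1(\pi_{\Pi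 Y}\circ r)$, where $\pi_{\Pi Y}:\Pi\to Y$ is the projection. **Theorem.** Let $L=\mathcal L\omega$ be a smooth affine Lagrangian density, i.e. $\mathcal L=b^\lambda_i\,y^i_\lambda+c$ in fibred coordinates, with $b^\lambda_i$, $c$ functions of the coordinates $(x^\mu,y^j)$ of $Y$. 1. For every connection $\Gamma$ on $Y$, $$H=H_\Gamma+L\circ\Gamma=p^\lambda_i\,dy^i\wedge\omega_\lambda-(p^\lambda_i-b^\lambda_i)\Gamma^i_\lambda\,\omega+c\,\omega$$ is a Hamiltonian form associated with $L$, and its momentum morphism is $y^i_\lambda\circ\widehat H=\Gamma^i_\lambda$. 2. For this $H$ and every section $r$ of $\Pi\to X$, with $s=\pi_{\Pi Y}\circ r$, the Hamilton equations (a) hold if and only if $J^1s=\Gamma\circ s$. 3. For every section $s$ of $Y\to X$ there is a connection $\Gamma$ with $J^1s=\Gamma\circ s$, and then $\widehat H\circ\widehat L\circ J^1s=J^1s$ for the corresponding $H$. 4. $L$ is semiregular, and the forms $H_\Gamma+L\circ\Gamma$, $\Gamma$ running over all connections on $Y$, constitute a complete family of Hamiltonian forms associated with $L$. -/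

import Mathlib

open scoped Manifold ContDiff

noncomputable section

/-! ### Linear algebra: exterior products of covectors -/

/-- The determinant as a continuous alternating `n`-form on `ℝⁿ`. -/
def detForm (n : ℕ) : (Fin n → ℝ) [⋀^Fin n]→L[ℝ] ℝ :=
  { (Matrix.detRowAlternating : (Fin n → ℝ) [⋀^Fin n]→ₗ[ℝ] ℝ) with
    cont := Continuous.matrix_det (A := fun M : Fin n → Fin n → ℝ => Matrix.of M) continuous_id }

/-- The exterior product `α₁ ∧ ⋯ ∧ αₙ` of `n` covectors:
`(u₁, …, uₙ) ↦ det (α_μ (u_k))`. -/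
def wedge {n : ℕ} {E : Type*} [AddCommGroup E] [Module ℝ E] [TopologicalSpace E]
    (α : Fin n → E →L[ℝ] ℝ) : E [⋀^Fin n]→L[ℝ] ℝ :=
  (detForm n).compContinuousLinearMap (ContinuousLinearMap.pi α)

instance tangentSpace_finiteDimensional {k : ℕ} {M : Type*} [TopologicalSpace M]
    [ChartedSpace (EuclideanSpace ℝ (Fin k)) M] (x : M) :
    FiniteDimensional ℝ (TangentSpace (𝓡 k) x) :=
  inferInstanceAs (FiniteDimensional ℝ (EuclideanSpace ℝ (Fin k)))

instance tangentSpace_t2Space {k : ℕ} {M : Type*} [TopologicalSpace M]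
    [ChartedSpace (EuclideanSpace ℝ (Fin k)) M] (x : M) :
    T2Space (TangentSpace (𝓡 k) x) :=
  inferInstanceAs (T2Space (EuclideanSpace ℝ (Fin k)))

/-- A basis of the tangent space `TₓM` (the one given by the preferred chart at `x`). -/
def frame {k : ℕ} {M : Type*} [TopologicalSpace M]
    [ChartedSpace (EuclideanSpace ℝ (Fin k)) M] (x : M) (l : Fin k) : TangentSpace (𝓡 k) x :=
  (EuclideanSpace.single l (1 : ℝ) : EuclideanSpace ℝ (Fin k))

/-- The basis of `Tₓ*M` dual to `frame x`. -/
def coframe {k : ℕ} {M : Type*} [TopologicalSpace M]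
    [ChartedSpace (EuclideanSpace ℝ (Fin k)) M] (x : M) (l : Fin k) :
    TangentSpace (𝓡 k) x →L[ℝ] ℝ :=
  (EuclideanSpace.proj l : EuclideanSpace ℝ (Fin k) →L[ℝ] ℝ)

/-! ### Fibred manifolds and fibred coordinates -/

/-- A fibred manifold `π : Y → X`: a smooth surjective submersion, `dim X = n`,
`dim Y = n + m`. -/
structure FibredManifold (n m : ℕ) (X Y : Type*)
    [TopologicalSpace X] [ChartedSpace (EuclideanSpace ℝ (Fin n)) X]
    [TopologicalSpace Y] [ChartedSpace (EuclideanSpace ℝ (Fin (n + m))) Y] where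
  proj : Y → X
  smooth : ContMDiff (𝓡 (n + m)) (𝓡 n) ∞ proj
  surjective : Function.Surjective proj
  submersion : ∀ y, Function.Surjective (mfderiv (𝓡 (n + m)) (𝓡 n) proj y)

variable {n m : ℕ} {X Y : Type*}
  [TopologicalSpace X] [ChartedSpace (EuclideanSpace ℝ (Fin n)) X]
  [TopologicalSpace Y] [ChartedSpace (EuclideanSpace ℝ (Fin (n + m))) Y]

/-- Fibred coordinates `(x^λ, y^i)` on an open subset `total.source` of `Y`, over coordinates
`(x^λ)` on an open subset `base.source` of `X`. -/
structure FibredChart (π : FibredManifold n m X Y) where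
  base : OpenPartialHomeomorph X (Fin n → ℝ)
  base_smooth : ContMDiffOn (𝓡 n) 𝓘(ℝ, Fin n → ℝ) ∞ base base.source
  base_symm_smooth : ContMDiffOn 𝓘(ℝ, Fin n → ℝ) (𝓡 n) ∞ base.symm base.target
  total : OpenPartialHomeomorph Y ((Fin n → ℝ) × (Fin m → ℝ))
  total_smooth : ContMDiffOn (𝓡 (n + m)) 𝓘(ℝ, (Fin n → ℝ) × (Fin m → ℝ)) ∞ total total.source
  total_symm_smooth :
    ContMDiffOn 𝓘(ℝ, (Fin n → ℝ) × (Fin m → ℝ)) (𝓡 (n + m)) ∞ total.symm total.target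
  proj_mem : ∀ y ∈ total.source, π.proj y ∈ base.source
  fst_total : ∀ y ∈ total.source, (total y).1 = base (π.proj y)

/-- The vertical tangent space `V_y Y`. -/
abbrev Vert (π : FibredManifold n m X Y) (y : Y) : Submodule ℝ (TangentSpace (𝓡 (n + m)) y) :=
  LinearMap.ker (mfderiv (𝓡 (n + m)) (𝓡 n) π.proj y).toLinearMap

/-- The space `Λⁿ Tₓ*X` of densities at `x`. -/
abbrev Dens (n : ℕ) {X : Type*} [TopologicalSpace X] [ChartedSpace (EuclideanSpace ℝ (Fin n)) X]
    (x : X) : Type :=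
  (TangentSpace (𝓡 n) x) [⋀^Fin n]→L[ℝ] ℝ

namespace FibredChart

variable {π : FibredManifold n m X Y} (φ : FibredChart π)

/-- The differential of the coordinate map of the base at `x ∈ X`. -/
def dbase (x : X) : TangentSpace (𝓡 n) x →L[ℝ] (Fin n → ℝ) :=
  mfderiv (𝓡 n) 𝓘(ℝ, Fin n → ℝ) φ.base x

/-- The differential of the inverse of the coordinate map of the base, as a map into `TₓX`. -/
def dbaseSymm (x : X) : (Fin n → ℝ) →L[ℝ] TangentSpace (𝓡 n) x :=
  mfderiv 𝓘(ℝ, Fin n → ℝ) (𝓡 n) φ.base.symm (φ.base x)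

/-- The covector `dx^λ` at `x ∈ X`. -/
def dx (x : X) (l : Fin n) : TangentSpace (𝓡 n) x →L[ℝ] ℝ :=
  (ContinuousLinearMap.proj l).comp (φ.dbase x)

/-- The coordinate vector `∂_λ` at `x ∈ X`. -/
def ddx (x : X) (l : Fin n) : TangentSpace (𝓡 n) x :=
  φ.dbaseSymm x (Pi.single l 1)

/-- The differential of the coordinate map at `y ∈ Y`. -/
def dtotal (y : Y) : TangentSpace (𝓡 (n + m)) y →L[ℝ] (Fin n → ℝ) × (Fin m → ℝ) :=
  mfderiv (𝓡 (n + m)) 𝓘(ℝ, (Fin n → ℝ) × (Fin m → ℝ)) φ.total y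

/-- The differential of the inverse of the coordinate map, as a map into `T_y Y`. -/
def dtotalSymm (y : Y) : (Fin n → ℝ) × (Fin m → ℝ) →L[ℝ] TangentSpace (𝓡 (n + m)) y :=
  mfderiv 𝓘(ℝ, (Fin n → ℝ) × (Fin m → ℝ)) (𝓡 (n + m)) φ.total.symm (φ.total y)

/-- The covector `dx^λ` at `y ∈ Y`. -/
def dxY (y : Y) (l : Fin n) : TangentSpace (𝓡 (n + m)) y →L[ℝ] ℝ :=
  (ContinuousLinearMap.proj l).comp ((ContinuousLinearMap.fst ℝ _ _).comp (φ.dtotal y))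

/-- The covector `dy^i` at `y ∈ Y`. -/
def dy (y : Y) (i : Fin m) : TangentSpace (𝓡 (n + m)) y →L[ℝ] ℝ :=
  (ContinuousLinearMap.proj i).comp ((ContinuousLinearMap.snd ℝ _ _).comp (φ.dtotal y))

/-- The coordinate vector `∂_λ` at `y ∈ Y`. -/
def ddxY (y : Y) (l : Fin n) : TangentSpace (𝓡 (n + m)) y :=
  φ.dtotalSymm y (Pi.single l 1, 0)

/-- The coordinate vector `∂_i` at `y ∈ Y`. -/
def ddy (y : Y) (i : Fin m) : TangentSpace (𝓡 (n + m)) y :=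
  φ.dtotalSymm y (0, Pi.single i 1)

theorem mfderiv_proj_dtotalSymm {y : Y} (hy : y ∈ φ.total.source)
    (w : (Fin n → ℝ) × (Fin m → ℝ)) :
    mfderiv (𝓡 (n + m)) (𝓡 n) π.proj y (φ.dtotalSymm y w) =
      φ.dbaseSymm (π.proj y) w.1 := by
  have hz : φ.total y ∈ φ.total.target := φ.total.map_source hy
  have hbt : φ.base (π.proj y) ∈ φ.base.target := φ.base.map_source (φ.proj_mem y hy)
  have h1 : MDifferentiableAt 𝓘(ℝ, (Fin n → ℝ) × (Fin m → ℝ)) (𝓡 (n + m)) φ.total.symm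
      (φ.total y) :=
    ((φ.total_symm_smooth _ hz).contMDiffAt
      (φ.total.open_target.mem_nhds hz)).mdifferentiableAt (by simp)
  have h2 : MDifferentiableAt (𝓡 (n + m)) (𝓡 n) π.proj (φ.total.symm (φ.total y)) :=
    (π.smooth _).mdifferentiableAt (by simp)
  have h3 : MDifferentiableAt 𝓘(ℝ, Fin n → ℝ) (𝓡 n) φ.base.symm (φ.total y).1 := by
    rw [φ.fst_total y hy]
    exact ((φ.base_symm_smooth _ hbt).contMDiffAt
      (φ.base.open_target.mem_nhds hbt)).mdifferentiableAt (by simp)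
  have h4 : MDifferentiableAt 𝓘(ℝ, (Fin n → ℝ) × (Fin m → ℝ)) 𝓘(ℝ, Fin n → ℝ)
      (Prod.fst : (Fin n → ℝ) × (Fin m → ℝ) → _) (φ.total y) :=
    differentiableAt_fst.mdifferentiableAt
  have heq : π.proj ∘ φ.total.symm =ᶠ[nhds (φ.total y)] φ.base.symm ∘ Prod.fst := by
    filter_upwards [φ.total.open_target.mem_nhds hz] with z hz'
    have hs := φ.total.map_target hz'
    have := φ.fst_total _ hs
    rw [φ.total.right_inv hz'] at this
    simp only [Function.comp, this]
    exact (φ.base.left_inv (φ.proj_mem _ hs)).symm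
  have hd := heq.mfderiv_eq (I := 𝓘(ℝ, (Fin n → ℝ) × (Fin m → ℝ))) (I' := 𝓡 n)
  rw [mfderiv_comp _ h2 h1, mfderiv_comp _ h3 h4] at hd
  have hd' := DFunLike.congr_fun hd w
  have h5 : mfderiv 𝓘(ℝ, (Fin n → ℝ) × (Fin m → ℝ)) 𝓘(ℝ, Fin n → ℝ)
      (Prod.fst : (Fin n → ℝ) × (Fin m → ℝ) → _) (φ.total y) =
      ContinuousLinearMap.fst ℝ (Fin n → ℝ) (Fin m → ℝ) := by
    rw [mfderiv_eq_fderiv]; exact fderiv_fst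
  rw [h5] at hd'
  have h6 : φ.total.symm (φ.total y) = y := φ.total.left_inv hy
  have key : ∀ y' : Y, y' = y → ∀ a : Fin n → ℝ, a = φ.base (π.proj y) →
      ((mfderiv (𝓡 (n + m)) (𝓡 n) π.proj y' :
          EuclideanSpace ℝ (Fin (n + m)) →L[ℝ] EuclideanSpace ℝ (Fin n))
        (φ.dtotalSymm y w : EuclideanSpace ℝ (Fin (n + m))) =
      (mfderiv 𝓘(ℝ, Fin n → ℝ) (𝓡 n) φ.base.symm a :
        (Fin n → ℝ) →L[ℝ] EuclideanSpace ℝ (Fin n)) w.1) →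
      ((mfderiv (𝓡 (n + m)) (𝓡 n) π.proj y :
          EuclideanSpace ℝ (Fin (n + m)) →L[ℝ] EuclideanSpace ℝ (Fin n))
        (φ.dtotalSymm y w : EuclideanSpace ℝ (Fin (n + m))) =
      (mfderiv 𝓘(ℝ, Fin n → ℝ) (𝓡 n) φ.base.symm (φ.base (π.proj y)) :
        (Fin n → ℝ) →L[ℝ] EuclideanSpace ℝ (Fin n)) w.1) := by
    rintro y' rfl a rfl h; exact h
  exact key _ h6 _ (φ.fst_total y hy) hd'

theorem ddy_mem {y : Y} (hy : y ∈ φ.total.source) (i : Fin m) : φ.ddy y i ∈ Vert π y :=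
  (φ.mfderiv_proj_dtotalSymm hy (0, Pi.single i 1)).trans (map_zero _)

theorem mfderiv_proj_ddxY {y : Y} (hy : y ∈ φ.total.source) (l : Fin n) :
    mfderiv (𝓡 (n + m)) (𝓡 n) π.proj y (φ.ddxY y l) = φ.ddx (π.proj y) l :=
  φ.mfderiv_proj_dtotalSymm hy (Pi.single l 1, 0)

theorem sum_dx_ddx {x : X} (hx : x ∈ φ.base.source) (w : TangentSpace (𝓡 n) x) :
    ∑ l, φ.dx x l w • φ.ddx x l = w := by
  have hbt : φ.base x ∈ φ.base.target := φ.base.map_source hx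
  have h1 : MDifferentiableAt (𝓡 n) 𝓘(ℝ, Fin n → ℝ) φ.base x :=
    ((φ.base_smooth _ hx).contMDiffAt
      (φ.base.open_source.mem_nhds hx)).mdifferentiableAt (by simp)
  have h2 : MDifferentiableAt 𝓘(ℝ, Fin n → ℝ) (𝓡 n) φ.base.symm (φ.base x) :=
    ((φ.base_symm_smooth _ hbt).contMDiffAt
      (φ.base.open_target.mem_nhds hbt)).mdifferentiableAt (by simp)
  have heq : φ.base.symm ∘ φ.base =ᶠ[nhds x] id := by
    filter_upwards [φ.base.open_source.mem_nhds hx] with z hz'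
    exact φ.base.left_inv hz'
  have hd := heq.mfderiv_eq (I := 𝓡 n) (I' := 𝓡 n)
  rw [mfderiv_comp _ h2 h1, mfderiv_id] at hd
  have h3 : φ.dbaseSymm x (φ.dbase x w) = w := DFunLike.congr_fun hd w
  have hpi : φ.dbase x w = ∑ l, φ.dx x l w • (Pi.single l (1 : ℝ) : Fin n → ℝ) :=
    pi_eq_sum_univ' (φ.dbase x w)
  rw [hpi, map_sum] at h3
  simp only [map_smul] at h3
  exact h3

end FibredChart

/-! ### Jets, sections and connections -/

/-- The fibre `J¹_y Y` of the jet bundle: a first order jet at `x = π y` of sections through `y` is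
the tangent map `TₓX → T_y Y` of such a section, i.e. a right inverse of the differential of `π`. -/
def Jet (π : FibredManifold n m X Y) (y : Y) : Type :=
  {ℓ : TangentSpace (𝓡 n) (π.proj y) →L[ℝ] TangentSpace (𝓡 (n + m)) y //
    ∀ w, mfderiv (𝓡 (n + m)) (𝓡 n) π.proj y (ℓ w) = w}

/-- The first order jet manifold `J¹Y` (as a set). -/
abbrev JetBundle (π : FibredManifold n m X Y) : Type _ := Σ y : Y, Jet π y

/-- `T*X ⊗ VY` at `y`, on which the affine space `J¹_y Y` is modelled. -/
abbrev VertHom (π : FibredManifold n m X Y) (y : Y) : Type :=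
  TangentSpace (𝓡 n) (π.proj y) →L[ℝ] Vert π y

/-- The affine structure of `J¹_y Y`: translation of a jet by an element of `T*X ⊗ VY`. -/
def Jet.translate {π : FibredManifold n m X Y} {y : Y} (ℓ : Jet π y) (σ : VertHom π y) : Jet π y :=
  ⟨ℓ.1 + (Vert π y).subtypeL.comp σ, fun w => by
    have h : mfderiv (𝓡 (n + m)) (𝓡 n) π.proj y (σ w : TangentSpace (𝓡 (n + m)) y) = 0 :=
      (σ w).2
    have h' := ℓ.2 w
    rw [add_apply, map_add, h']
    exact (congrArg (w + ·) h).trans (add_zero w)⟩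

namespace FibredChart

variable {π : FibredManifold n m X Y} (φ : FibredChart π)

/-- The jet coordinates `y^i_λ` of a jet. -/
def jetCoord {y : Y} (ℓ : Jet π y) : Fin m → Fin n → ℝ :=
  fun i l => φ.dy y i (ℓ.1 (φ.ddx (π.proj y) l))

/-- The jet `dx^λ ⊗ (∂_λ + v^i_λ ∂_i)` at `y` with jet coordinates `v^i_λ`. -/
def jetOf {y : Y} (hy : y ∈ φ.total.source) (v : Fin m → Fin n → ℝ) : Jet π y :=
  ⟨∑ l, (φ.dx (π.proj y) l).smulRight (φ.ddxY y l + ∑ i, v i l • φ.ddy y i), fun w => by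
    have h0 : ∀ i, mfderiv (𝓡 (n + m)) (𝓡 n) π.proj y (φ.ddy y i) = 0 :=
      fun i => φ.ddy_mem hy i
    simp only [sum_apply, ContinuousLinearMap.smulRight_apply, map_sum,
      map_smul, map_add, φ.mfderiv_proj_ddxY hy, h0, smul_zero, Finset.sum_const_zero, add_zero]
    exact φ.sum_dx_ddx (φ.proj_mem y hy) w⟩

/-- The partial derivative `∂_λ f` of a (locally defined) function on `X`. -/
def pd (f : X → ℝ) (l : Fin n) (x : X) : ℝ :=
  fderiv ℝ (f ∘ φ.base.symm) (φ.base x) (Pi.single l 1)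

end FibredChart

/-- Sections of `π : Y → X`. -/
structure IsSection (π : FibredManifold n m X Y) (s : X → Y) : Prop where
  smooth : ContMDiff (𝓡 n) (𝓡 (n + m)) ∞ s
  proj_eq : ∀ x, π.proj (s x) = x

/-- The jet prolongation `J¹s : X → J¹Y` of a section. -/
def jetProlongation {π : FibredManifold n m X Y} {s : X → Y} (hs : IsSection π s) (x : X) :
    JetBundle π :=
  ⟨s x, ⟨mfderiv (𝓡 n) (𝓡 (n + m)) s x, by
    have h1 : MDifferentiableAt (𝓡 n) (𝓡 (n + m)) s x :=
      (hs.smooth x).mdifferentiableAt (by simp)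
    have h2 : MDifferentiableAt (𝓡 (n + m)) (𝓡 n) π.proj (s x) :=
      (π.smooth _).mdifferentiableAt (by simp)
    have heq : π.proj ∘ s = id := funext hs.proj_eq
    have hd := mfderiv_comp x h2 h1
    rw [heq, mfderiv_id] at hd
    exact fun w => (DFunLike.congr_fun hd w).symm⟩⟩

/-- Sections of the jet manifold `J¹Y → X`. -/
structure IsJetSection (π : FibredManifold n m X Y) (t : X → JetBundle π) : Prop where
  isSection : IsSection π (fun x => (t x).1)
  smooth : ∀ (φ : FibredChart π) (i : Fin m) (l : Fin n),
    ContMDiffOn (𝓡 n) 𝓘(ℝ, ℝ) ∞ (fun x => φ.jetCoord (t x).2 i l) {x | (t x).1 ∈ φ.total.source}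

/-- A connection on `Y → X`: a global smooth section `Γ` of `J¹Y → Y`. -/
def IsConnection (π : FibredManifold n m X Y) (Γ : ∀ y, Jet π y) : Prop :=
  ∀ (φ : FibredChart π) (i : Fin m) (l : Fin n),
    ContMDiffOn (𝓡 (n + m)) 𝓘(ℝ, ℝ) ∞ (fun y => φ.jetCoord (Γ y) i l) φ.total.source

/-! ### Lagrangian densities -/

/-- A first order Lagrangian density, as a fibred map `J¹Y → Λⁿ T*X` over `X`
(smoothness is `IsSmoothLagrangian`). -/
abbrev Lagrangian (π : FibredManifold n m X Y) : Type _ := ∀ y, Jet π y → Dens n (π.proj y)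

open Classical in
/-- The coordinate expression `ℒ(x, y, v)`, `L = ℒ ω`, of a Lagrangian density; its argument is
`((x, y), v)` (it matters only for `(x, y) ∈ φ.total.target`). -/
def FibredChart.lag {π : FibredManifold n m X Y} (φ : FibredChart π) (L : Lagrangian π)
    (a : ((Fin n → ℝ) × (Fin m → ℝ)) × (Fin m → Fin n → ℝ)) : ℝ :=
  if h : a.1 ∈ φ.total.target then
    L (φ.total.symm a.1) (φ.jetOf (φ.total.map_target h) a.2)
      (fun l => φ.ddx (π.proj (φ.total.symm a.1)) l)
  else 0

/-- `L` is of class `C^∞` on `J¹Y`. -/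
def IsSmoothLagrangian {π : FibredManifold n m X Y} (L : Lagrangian π) : Prop :=
  ∀ φ : FibredChart π, ContDiffOn ℝ ∞ (φ.lag L) (φ.total.target ×ˢ Set.univ)

/-- In the coordinates `φ` one has `ℒ = b^λ_i(x, y) y^i_λ + c(x, y)`. -/
def HasAffineExpr {π : FibredManifold n m X Y} (L : Lagrangian π) (φ : FibredChart π)
    (b : (Fin n → ℝ) × (Fin m → ℝ) → Fin n → Fin m → ℝ)
    (c : (Fin n → ℝ) × (Fin m → ℝ) → ℝ) : Prop :=
  ∀ z ∈ φ.total.target, ∀ v : Fin m → Fin n → ℝ,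
    φ.lag L (z, v) = ∑ l, ∑ i, b z l i * v i l + c z

/-- Affine Lagrangian densities. -/
def IsAffineLagrangian {π : FibredManifold n m X Y} (L : Lagrangian π) : Prop :=
  ∀ φ : FibredChart π, ∃ b c, HasAffineExpr L φ b c

/-- The derivative `∂^λ_i ℒ`. -/
def FibredChart.lagMomentum {π : FibredManifold n m X Y} (φ : FibredChart π) (L : Lagrangian π)
    (l : Fin n) (i : Fin m) (a : ((Fin n → ℝ) × (Fin m → ℝ)) × (Fin m → Fin n → ℝ)) : ℝ :=
  fderiv ℝ (φ.lag L) a (0, Pi.single i (Pi.single l 1))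

/-- The first order Euler–Lagrange equations for a section `t` of `J¹Y → X`:
`∂_λ t^i = t^i_λ` and
`∂_i ℒ - (∂_λ + t^j_λ ∂_j + ∂_λ t^j_μ ∂^μ_j) ∂^λ_i ℒ = 0`, in all fibred coordinates. -/
def IsEulerLagrangeSolution {π : FibredManifold n m X Y} (L : Lagrangian π)
    (t : X → JetBundle π) : Prop :=
  ∀ (φ : FibredChart π) (x : X), (t x).1 ∈ φ.total.source → ∀ i : Fin m,
    let a : ((Fin n → ℝ) × (Fin m → ℝ)) × (Fin m → Fin n → ℝ) :=
      (φ.total (t x).1, φ.jetCoord (t x).2)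
    (∀ l : Fin n, φ.pd (fun x' => (φ.total (t x').1).2 i) l x = φ.jetCoord (t x).2 i l) ∧
    fderiv ℝ (φ.lag L) a ((0, Pi.single i 1), 0)
      - ∑ l, (fderiv ℝ (φ.lagMomentum L l i) a ((Pi.single l 1, 0), 0)
        + ∑ j, φ.jetCoord (t x).2 j l *
            fderiv ℝ (φ.lagMomentum L l i) a ((0, Pi.single j 1), 0)
        + ∑ j, ∑ k, φ.pd (fun x' => φ.jetCoord (t x').2 j k) l x *
            fderiv ℝ (φ.lagMomentum L l i) a (0, Pi.single j (Pi.single k 1))) = 0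

/-! ### The Legendre manifold and the Legendre morphism -/

/-- The fibre at `y` of the Legendre manifold `Π = Λⁿ T*X ⊗ TX ⊗ V*Y`, written as
`Hom (T*X ⊗ VY, Λⁿ T*X)`: the element `p^λ_i ω ⊗ ∂_λ ⊗ dy^i` is `σ ↦ p^λ_i σ^i_λ ω`. -/
abbrev Momentum (π : FibredManifold n m X Y) (y : Y) : Type :=
  VertHom π y →ₗ[ℝ] Dens n (π.proj y)

/-- The Legendre manifold `Π` (as a set). -/
abbrev LegendreBundle (π : FibredManifold n m X Y) : Type _ := Σ y : Y, Momentum π y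

/-- The Legendre morphism `L̂ : J¹Y → Π`, i.e. the derivative of `L` along the fibres of
`J¹Y → Y`. -/
def legendre {π : FibredManifold n m X Y} (L : Lagrangian π) {y : Y} (ℓ : Jet π y) :
    Momentum π y :=
  (fderiv ℝ (fun σ : VertHom π y => L y (ℓ.translate σ)) 0).toLinearMap

namespace FibredChart

variable {π : FibredManifold n m X Y} (φ : FibredChart π)

open Classical in
/-- The momentum coordinates `p^λ_i` of a point of `Π` over `φ.total.source`. -/
def momCoord {y : Y} (p : Momentum π y) : Fin n → Fin m → ℝ :=
  fun l i => if hy : y ∈ φ.total.source then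
    p ((φ.dx (π.proj y) l).smulRight ⟨φ.ddy y i, φ.ddy_mem hy i⟩) (φ.ddx (π.proj y))
  else 0

/-- The point `P^λ_i ω ⊗ ∂_λ ⊗ dy^i` of `Π_y`, `ω = dx¹ ∧ ⋯ ∧ dxⁿ`. -/
def momOf (y : Y) (P : Fin n → Fin m → ℝ) : Momentum π y where
  toFun σ := (∑ l, ∑ i, P l i * φ.dy y i (σ (φ.ddx (π.proj y) l))) • wedge (φ.dx (π.proj y))
  map_add' σ τ := by
    simp only [add_apply, Submodule.coe_add, map_add, mul_add,
      Finset.sum_add_distrib, add_smul]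
  map_smul' r σ := by
    simp only [smul_apply, Submodule.coe_smul, map_smul, smul_eq_mul,
      mul_left_comm _ r, ← Finset.mul_sum, mul_smul, RingHom.id_apply]

end FibredChart

/-- `S` is an embedded submanifold of the vector space `E`. -/
def IsEmbeddedSubmanifold {E : Type*} [NormedAddCommGroup E] [NormedSpace ℝ E] (S : Set E) : Prop :=
  ∀ a ∈ S, ∃ (e : OpenPartialHomeomorph E E) (W : Submodule ℝ E), a ∈ e.source ∧
    ContDiffOn ℝ ∞ e e.source ∧ ContDiffOn ℝ ∞ e.symm e.target ∧
    e '' (S ∩ e.source) = (W : Set E) ∩ e.target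

/-- `L` is semiregular: the preimage under `L̂` of any point of `Q = L̂(J¹Y)` is a connected
submanifold of `J¹Y` (it lies in one fibre `J¹_y Y`, here described by the jet coordinates). -/
def IsSemiregular {π : FibredManifold n m X Y} (L : Lagrangian π) : Prop :=
  ∀ (φ : FibredChart π) (y : Y), y ∈ φ.total.source → ∀ q : Momentum π y,
    (∃ ℓ : Jet π y, legendre L ℓ = q) →
    IsConnected ((fun ℓ : Jet π y => φ.jetCoord ℓ) '' {ℓ | legendre L ℓ = q}) ∧
    IsEmbeddedSubmanifold ((fun ℓ : Jet π y => φ.jetCoord ℓ) '' {ℓ | legendre L ℓ = q})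

/-- Sections of the Legendre manifold `Π → X`. -/
structure IsLegendreSection (π : FibredManifold n m X Y) (r : X → LegendreBundle π) : Prop where
  isSection : IsSection π (fun x => (r x).1)
  smooth : ∀ (φ : FibredChart π) (l : Fin n) (i : Fin m),
    ContMDiffOn (𝓡 n) 𝓘(ℝ, ℝ) ∞ (fun x => φ.momCoord (r x).2 l i) {x | (r x).1 ∈ φ.total.source}

/-! ### Hamiltonian forms -/

/-- Exterior `n`-forms on `Π` that are horizontal over `Y`: the form at `p ∈ Π_y` is the pullback
by `Π → Y` of the given `n`-form on `T_y Y`. -/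
abbrev SemibasicForm (π : FibredManifold n m X Y) : Type _ :=
  ∀ y, Momentum π y → (TangentSpace (𝓡 (n + m)) y) [⋀^Fin n]→L[ℝ] ℝ

namespace FibredChart

variable {π : FibredManifold n m X Y} (φ : FibredChart π)

/-- The function `ℋ(x, y, p) = - H(∂_1, …, ∂_n)`, with argument `((x, y), p)`; it is the `ℋ` of
`H = p^λ_i dy^i ∧ ω_λ - ℋ ω`. -/
def ham (H : SemibasicForm π)
    (a : ((Fin n → ℝ) × (Fin m → ℝ)) × (Fin n → Fin m → ℝ)) : ℝ :=
  - H (φ.total.symm a.1) (φ.momOf (φ.total.symm a.1) a.2) (φ.ddxY (φ.total.symm a.1))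

/-- The form `P^λ_i dy^i ∧ ω_λ - h ω` at `y`, `ω = dx¹ ∧ ⋯ ∧ dxⁿ`, `ω_λ = ∂_λ ⌋ ω`.
Here `dy^i ∧ ω_λ` is the product `dx¹ ∧ ⋯ ∧ dxⁿ` with the factor `dx^λ` replaced by `dy^i`. -/
def hamExpr (y : Y) (P : Fin n → Fin m → ℝ) (h : ℝ) :
    (TangentSpace (𝓡 (n + m)) y) [⋀^Fin n]→L[ℝ] ℝ :=
  ∑ l, ∑ i, P l i • wedge (Function.update (φ.dxY y) l (φ.dy y i)) - h • wedge (φ.dxY y)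

end FibredChart

/-- Hamiltonian forms: in all fibred coordinates `H = p^λ_i dy^i ∧ ω_λ - ℋ ω`, `ℋ` smooth. -/
def IsHamiltonianForm {π : FibredManifold n m X Y} (H : SemibasicForm π) : Prop :=
  ∀ φ : FibredChart π, ContDiffOn ℝ ∞ (φ.ham H) (φ.total.target ×ˢ Set.univ) ∧
    ∀ y ∈ φ.total.source, ∀ p : Momentum π y,
      H y p = φ.hamExpr y (φ.momCoord p) (φ.ham H (φ.total y, φ.momCoord p))

/-- Momentum morphisms `Π → J¹Y` over `Y`. -/
abbrev MomentumMorphism (π : FibredManifold n m X Y) : Type _ := ∀ y, Momentum π y → Jet π y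

/-- The projection of `T_y Y` onto `V_y Y` along the horizontal space of a jet. -/
def vertProj {π : FibredManifold n m X Y} {y : Y} (ℓ : Jet π y) :
    TangentSpace (𝓡 (n + m)) y →ₗ[ℝ] Vert π y :=
  LinearMap.codRestrict (Vert π y)
    (LinearMap.id -
      ℓ.1.toLinearMap.comp (mfderiv (𝓡 (n + m)) (𝓡 n) π.proj y).toLinearMap)
    (fun u => (map_sub (mfderiv (𝓡 (n + m)) (𝓡 n) π.proj y) _ _).trans
      (sub_eq_zero.2 (ℓ.2 (mfderiv (𝓡 (n + m)) (𝓡 n) π.proj y u)).symm))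

/-- The linear map `v ↦ c ⊗ v`. -/
def tensorLin {E V : Type*} [AddCommGroup E] [Module ℝ E] [TopologicalSpace E]
    [AddCommGroup V] [Module ℝ V] [TopologicalSpace V] [IsTopologicalAddGroup V]
    [ContinuousSMul ℝ V] (c : E →L[ℝ] ℝ) : V →ₗ[ℝ] (E →L[ℝ] V) where
  toFun v := c.smulRight v
  map_add' v w := by ext x; simp
  map_smul' r v := by ext x; simp [smul_comm r (c x) v]

/-- Evaluation of densities at `x` on the frame. -/
def evalFrame (x : X) : Dens n x →ₗ[ℝ] ℝ where
  toFun d := d (frame x)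
  map_add' _ _ := rfl
  map_smul' _ _ := rfl

/-- The covector `p^λ_i (dy^i - Φ^i_μ dx^μ)` on `T_y Y`, relative to the frame of `TₓX`:
the vertical part of a vector is tensored with `dx^λ` and paired with `p`, and the resulting
density is evaluated on the frame. -/
def vertCovector {π : FibredManifold n m X Y} {y : Y} (p : Momentum π y) (ℓ : Jet π y)
    (l : Fin n) : TangentSpace (𝓡 (n + m)) y →ₗ[ℝ] ℝ :=
  ((evalFrame (π.proj y)).comp p).comp
    ((tensorLin (coframe (π.proj y) l)).comp (vertProj ℓ))

/-- The Hamiltonian form `H_Φ = Φ ⌋ θ = p^λ_i dy^i ∧ ω_λ - p^λ_i Φ^i_λ ω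
= p^λ_i (dy^i - Φ^i_μ dx^μ) ∧ ω_λ` of a momentum morphism `Φ`. The expression does not depend
on the frame of `TₓX` in which it is computed. -/
def hamOf {π : FibredManifold n m X Y} (Φ : MomentumMorphism π) : SemibasicForm π :=
  fun y p => ∑ l, wedge (Function.update
    (fun k => (coframe (π.proj y) k).comp (mfderiv (𝓡 (n + m)) (𝓡 n) π.proj y)) l
    (LinearMap.toContinuousLinearMap (vertCovector p (Φ y p) l)))

/-- The horizontal density `L ∘ Φ` on `Π`. -/
def lagComp {π : FibredManifold n m X Y} (L : Lagrangian π) (Φ : MomentumMorphism π) :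
    SemibasicForm π :=
  fun y p => (L y (Φ y p)).compContinuousLinearMap (mfderiv (𝓡 (n + m)) (𝓡 n) π.proj y)

/-- `Φ` is the momentum morphism `Ĥ` of `H`: `y^i_λ ∘ Φ = ∂^i_λ ℋ` in all fibred coordinates.
This determines `Φ`. -/
def IsMomentumMorphismOf {π : FibredManifold n m X Y} (H : SemibasicForm π)
    (Φ : MomentumMorphism π) : Prop :=
  ∀ (φ : FibredChart π) (y : Y), y ∈ φ.total.source → ∀ (p : Momentum π y) (i : Fin m) (l : Fin n),
    φ.jetCoord (Φ y p) i l =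
      fderiv ℝ (φ.ham H) (φ.total y, φ.momCoord p) (0, Pi.single l (Pi.single i 1))

/-- The Hamiltonian form `H` is associated with `L`: `L̂ ∘ Ĥ = Id` on `Q = L̂(J¹Y)` and
`H = H_Ĥ + L ∘ Ĥ`. -/
def IsAssociated {π : FibredManifold n m X Y} (L : Lagrangian π) (H : SemibasicForm π) : Prop :=
  IsHamiltonianForm H ∧ ∃ Φ : MomentumMorphism π, IsMomentumMorphismOf H Φ ∧
    (∀ (y : Y) (ℓ : Jet π y), legendre L (Φ y (legendre L ℓ)) = legendre L ℓ) ∧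
    H = fun y p => hamOf Φ y p + lagComp L Φ y p

/-- The first group of Hamilton equations, `∂_λ r^i = ∂^i_λ ℋ`, in all fibred coordinates. -/
def HamiltonEqFst {π : FibredManifold n m X Y} (H : SemibasicForm π)
    (r : X → LegendreBundle π) : Prop :=
  ∀ (φ : FibredChart π) (x : X), (r x).1 ∈ φ.total.source → ∀ (i : Fin m) (l : Fin n),
    φ.pd (fun x' => (φ.total (r x').1).2 i) l x =
      fderiv ℝ (φ.ham H) (φ.total (r x).1, φ.momCoord (r x).2) (0, Pi.single l (Pi.single i 1))

/-- The second group of Hamilton equations, `∂_λ r^λ_i = - ∂_i ℋ`, in all fibred coordinates. -/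
def HamiltonEqSnd {π : FibredManifold n m X Y} (H : SemibasicForm π)
    (r : X → LegendreBundle π) : Prop :=
  ∀ (φ : FibredChart π) (x : X), (r x).1 ∈ φ.total.source → ∀ i : Fin m,
    ∑ l, φ.pd (fun x' => φ.momCoord (r x').2 l i) l x =
      - fderiv ℝ (φ.ham H) (φ.total (r x).1, φ.momCoord (r x).2) ((0, Pi.single i 1), 0)

/-- A family `F` of Hamiltonian forms associated with a semiregular Lagrangian density `L` is
complete: for each solution `t` of the first order Euler–Lagrange equations there are `H ∈ F` and a
solution `r` of the Hamilton equations for `H` with `r = L̂ ∘ t`, `t = Ĥ ∘ r` and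
`t = J¹(π_{ΠY} ∘ r)`. -/
def IsCompleteFamily {π : FibredManifold n m X Y} (L : Lagrangian π)
    (F : Set (SemibasicForm π)) : Prop :=
  IsSemiregular L ∧ (∀ H ∈ F, IsAssociated L H) ∧
  ∀ t : X → JetBundle π, IsJetSection π t → IsEulerLagrangeSolution L t →
    ∃ H ∈ F, ∃ (r : X → LegendreBundle π) (hr : IsLegendreSection π r),
      HamiltonEqFst H r ∧ HamiltonEqSnd H r ∧
      (∀ x, r x = ⟨(t x).1, legendre L (t x).2⟩) ∧
      (∃ Φ : MomentumMorphism π, IsMomentumMorphismOf H Φ ∧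
        ∀ x, t x = ⟨(r x).1, Φ (r x).1 (r x).2⟩) ∧
      ∀ x, t x = jetProlongation hr.isSection x

/-- The momentum morphism `Γ̂ = Γ ∘ π_{ΠY}` of a connection. -/
def liftConnection {π : FibredManifold n m X Y} (Γ : ∀ y, Jet π y) : MomentumMorphism π :=
  fun y _ => Γ y

/-- The form `H_Γ + L ∘ Γ`. -/
def affineHam {π : FibredManifold n m X Y} (L : Lagrangian π) (Γ : ∀ y, Jet π y) :
    SemibasicForm π :=
  fun y p => hamOf (liftConnection Γ) y p + lagComp L (liftConnection Γ) y p

end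

/-! For an affine Lagrangian the fibre derivative of `L` at a jet over `y` is the coefficient
`b(y)`, whatever the jet. So `L̂` is constant on each fibre `J¹_y Y` (`legendre_eq_of_affine`). Two
facts follow at once: every non-empty preimage under `L̂` is a whole fibre, an affine space, hence
`L` is semiregular; and `L̂ ∘ Φ = Id` on `Q` for every `Φ : Π → J¹Y` over `Y`.

In coordinates `H_Γ + L ∘ Γ` has `ℋ = (p - b)Γ - c`, affine in `p` with slope `Γ`. Hence `Ĥ = Γ`
(`fderiv_ham_momentum`), and the Hamilton equations (a) say that the jet coordinates of `J¹s` and `Γ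
∘ s` agree. The form is defined through an arbitrary frame, so its coordinate expression rests on
the frame independence of a contraction (`hamOf_eq_of_isDualPair`).

Completeness needs two more ingredients. The first is a connection through a given section `s`
(`exists_connection`): near `s(X)` extend the jet coordinates of `J¹s` constantly along the fibres
of `π`, elsewhere take any local jet field, and glue with a partition of unity, which is legitimate
because jets form an affine space. The second is that at `p = b`, `v = Γ` the derivatives of `ℋ` and
`-ℒ` along `Y` agree (`fderiv_ham_base`). Since `∂^λ_i ℒ = b^λ_i` does not involve the velocities,
the Euler–Lagrange equations for `t = J¹s` then turn into (b) for `r = L̂ ∘ t`. -/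

section

variable {n m : ℕ} {X Y : Type*}
  [TopologicalSpace X] [ChartedSpace (EuclideanSpace ℝ (Fin n)) X]
  [TopologicalSpace Y] [ChartedSpace (EuclideanSpace ℝ (Fin (n + m))) Y]

/-! ### Differentials of fibred coordinates and jet coordinates -/

namespace FibredChart

variable {π : FibredManifold n m X Y} (φ : FibredChart π)

theorem base_mdifferentiableAt {x : X} (hx : x ∈ φ.base.source) :
    MDifferentiableAt (𝓡 n) 𝓘(ℝ, Fin n → ℝ) φ.base x :=
  ((φ.base_smooth _ hx).contMDiffAt
    (φ.base.open_source.mem_nhds hx)).mdifferentiableAt (by simp)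

theorem base_symm_mdifferentiableAt {a : Fin n → ℝ} (ha : a ∈ φ.base.target) :
    MDifferentiableAt 𝓘(ℝ, Fin n → ℝ) (𝓡 n) φ.base.symm a :=
  ((φ.base_symm_smooth _ ha).contMDiffAt
    (φ.base.open_target.mem_nhds ha)).mdifferentiableAt (by simp)

theorem total_mdifferentiableAt {y : Y} (hy : y ∈ φ.total.source) :
    MDifferentiableAt (𝓡 (n + m)) 𝓘(ℝ, (Fin n → ℝ) × (Fin m → ℝ)) φ.total y :=
  ((φ.total_smooth _ hy).contMDiffAt
    (φ.total.open_source.mem_nhds hy)).mdifferentiableAt (by simp)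

theorem total_symm_mdifferentiableAt {z : (Fin n → ℝ) × (Fin m → ℝ)} (hz : z ∈ φ.total.target) :
    MDifferentiableAt 𝓘(ℝ, (Fin n → ℝ) × (Fin m → ℝ)) (𝓡 (n + m)) φ.total.symm z :=
  ((φ.total_symm_smooth _ hz).contMDiffAt
    (φ.total.open_target.mem_nhds hz)).mdifferentiableAt (by simp)

theorem dbase_dbaseSymm {x : X} (hx : x ∈ φ.base.source) (w : Fin n → ℝ) :
    φ.dbase x (φ.dbaseSymm x w) = w := by
  -- With `x` written as the image of a coordinate point, the base points of the two differentials
  -- match after a single rewrite, and no transport between tangent spaces is needed.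
  obtain ⟨a, ha, rfl⟩ : ∃ a ∈ φ.base.target, φ.base.symm a = x :=
    ⟨φ.base x, φ.base.map_source hx, φ.base.left_inv hx⟩
  have heq : φ.base ∘ φ.base.symm =ᶠ[nhds a] id := by
    filter_upwards [φ.base.open_target.mem_nhds ha] with z hz
    exact φ.base.right_inv hz
  have hd := heq.mfderiv_eq (I := 𝓘(ℝ, Fin n → ℝ)) (I' := 𝓘(ℝ, Fin n → ℝ))
  rw [mfderiv_comp _ (φ.base_mdifferentiableAt hx) (φ.base_symm_mdifferentiableAt ha),
    mfderiv_id] at hd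
  have h := DFunLike.congr_fun hd w
  unfold dbase dbaseSymm
  rw [φ.base.right_inv ha]
  exact h

theorem dtotal_dtotalSymm {y : Y} (hy : y ∈ φ.total.source) (w : (Fin n → ℝ) × (Fin m → ℝ)) :
    φ.dtotal y (φ.dtotalSymm y w) = w := by
  obtain ⟨a, ha, rfl⟩ : ∃ a ∈ φ.total.target, φ.total.symm a = y :=
    ⟨φ.total y, φ.total.map_source hy, φ.total.left_inv hy⟩
  have heq : φ.total ∘ φ.total.symm =ᶠ[nhds a] id := by
    filter_upwards [φ.total.open_target.mem_nhds ha] with z hz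
    exact φ.total.right_inv hz
  have hd := heq.mfderiv_eq (I := 𝓘(ℝ, (Fin n → ℝ) × (Fin m → ℝ)))
    (I' := 𝓘(ℝ, (Fin n → ℝ) × (Fin m → ℝ)))
  rw [mfderiv_comp _ (φ.total_mdifferentiableAt hy) (φ.total_symm_mdifferentiableAt ha),
    mfderiv_id] at hd
  have h := DFunLike.congr_fun hd w
  unfold dtotal dtotalSymm
  rw [φ.total.right_inv ha]
  exact h

theorem dtotalSymm_dtotal {y : Y} (hy : y ∈ φ.total.source) (u : TangentSpace (𝓡 (n + m)) y) :
    φ.dtotalSymm y (φ.dtotal y u) = u := by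
  have heq : φ.total.symm ∘ φ.total =ᶠ[nhds y] id := by
    filter_upwards [φ.total.open_source.mem_nhds hy] with z hz
    exact φ.total.left_inv hz
  have hd := heq.mfderiv_eq (I := 𝓡 (n + m)) (I' := 𝓡 (n + m))
  rw [mfderiv_comp _ (φ.total_symm_mdifferentiableAt (φ.total.map_source hy))
    (φ.total_mdifferentiableAt hy), mfderiv_id] at hd
  exact DFunLike.congr_fun hd u

theorem dtotal_fst {y : Y} (hy : y ∈ φ.total.source) (u : TangentSpace (𝓡 (n + m)) y) :
    (φ.dtotal y u).1 = φ.dbase (π.proj y) (mfderiv (𝓡 (n + m)) (𝓡 n) π.proj y u) := by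
  conv_rhs => rw [← φ.dtotalSymm_dtotal hy u, φ.mfderiv_proj_dtotalSymm hy,
    φ.dbase_dbaseSymm (φ.proj_mem y hy)]

theorem dxY_eq {y : Y} (hy : y ∈ φ.total.source) (l : Fin n) :
    φ.dxY y l = (φ.dx (π.proj y) l).comp (mfderiv (𝓡 (n + m)) (𝓡 n) π.proj y) := by
  ext u
  exact congrFun (φ.dtotal_fst hy u) l

theorem dx_ddx {x : X} (hx : x ∈ φ.base.source) (l k : Fin n) :
    φ.dx x l (φ.ddx x k) = if l = k then 1 else 0 := by
  have h := congrFun (φ.dbase_dbaseSymm hx (Pi.single k 1)) l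
  rw [Pi.single_apply] at h
  exact h

theorem dxY_ddxY {y : Y} (hy : y ∈ φ.total.source) (l k : Fin n) :
    φ.dxY y l (φ.ddxY y k) = if l = k then 1 else 0 := by
  have h := congrFun (congrArg Prod.fst (φ.dtotal_dtotalSymm hy (Pi.single k 1, 0))) l
  exact h.trans (Pi.single_apply ..)

theorem dy_ddxY {y : Y} (hy : y ∈ φ.total.source) (i : Fin m) (l : Fin n) :
    φ.dy y i (φ.ddxY y l) = 0 :=
  congrFun (congrArg Prod.snd (φ.dtotal_dtotalSymm hy (Pi.single l 1, 0))) i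

theorem dy_ddy {y : Y} (hy : y ∈ φ.total.source) (i j : Fin m) :
    φ.dy y i (φ.ddy y j) = if i = j then 1 else 0 := by
  have h := congrFun (congrArg Prod.snd (φ.dtotal_dtotalSymm hy (0, Pi.single j 1))) i
  exact h.trans (Pi.single_apply ..)

theorem tangent_decomp {y : Y} (hy : y ∈ φ.total.source) (u : TangentSpace (𝓡 (n + m)) y) :
    u = ∑ l, φ.dxY y l u • φ.ddxY y l + ∑ i, φ.dy y i u • φ.ddy y i := by
  have h : φ.dtotal y u = ∑ l, φ.dxY y l u • ((Pi.single l 1, 0) : (Fin n → ℝ) × (Fin m → ℝ)) +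
      ∑ i, φ.dy y i u • ((0, Pi.single i 1) : (Fin n → ℝ) × (Fin m → ℝ)) := by
    refine Prod.ext ?_ ?_
    · simp only [Prod.fst_add, Prod.fst_sum, Prod.smul_fst, smul_zero, Finset.sum_const_zero,
        add_zero]
      exact pi_eq_sum_univ' _
    · simp only [Prod.snd_add, Prod.snd_sum, Prod.smul_snd, smul_zero, Finset.sum_const_zero,
        zero_add]
      exact pi_eq_sum_univ' _
  conv_lhs => rw [← φ.dtotalSymm_dtotal hy u, h]
  simp only [map_add, map_sum, map_smul]
  rfl

theorem dxY_jet {y : Y} (hy : y ∈ φ.total.source) (ℓ : Jet π y) (l : Fin n)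
    (w : TangentSpace (𝓡 n) (π.proj y)) : φ.dxY y l (ℓ.1 w) = φ.dx (π.proj y) l w := by
  rw [φ.dxY_eq hy]
  exact congrArg (φ.dx (π.proj y) l) (ℓ.2 w)

/-- A right inverse of `dπ` has its `dx`-components prescribed, so only the `dy`-components are
free. This is why jet coordinates determine the jet. -/
theorem jet_ddx {y : Y} (hy : y ∈ φ.total.source) (ℓ : Jet π y) (l : Fin n) :
    ℓ.1 (φ.ddx (π.proj y) l) = φ.ddxY y l + ∑ i, φ.jetCoord ℓ i l • φ.ddy y i := by
  rw [φ.tangent_decomp hy (ℓ.1 (φ.ddx (π.proj y) l))]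
  congr 1
  simp only [φ.dxY_jet hy, φ.dx_ddx (φ.proj_mem y hy), ite_smul, one_smul, zero_smul,
    Finset.sum_ite_eq', Finset.mem_univ, if_true]

theorem jetCoord_injective {y : Y} (hy : y ∈ φ.total.source) {ℓ ℓ' : Jet π y}
    (h : φ.jetCoord ℓ = φ.jetCoord ℓ') : ℓ = ℓ' := by
  refine Subtype.ext (ContinuousLinearMap.ext fun w => ?_)
  rw [← φ.sum_dx_ddx (φ.proj_mem y hy) w]
  simp only [map_sum, map_smul, φ.jet_ddx hy, h]

theorem jetCoord_jetOf {y : Y} (hy : y ∈ φ.total.source) (v : Fin m → Fin n → ℝ) :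
    φ.jetCoord (φ.jetOf hy v) = v := by
  funext i l
  simp only [jetCoord, jetOf, sum_apply, ContinuousLinearMap.smulRight_apply,
    φ.dx_ddx (φ.proj_mem y hy), ite_smul, one_smul, zero_smul, Finset.sum_ite_eq',
    Finset.sum_ite_eq, Finset.mem_univ, if_true, map_add, map_sum, map_smul, φ.dy_ddxY hy,
    φ.dy_ddy hy, smul_eq_mul, mul_ite, mul_one, mul_zero, zero_add]

theorem jetOf_jetCoord {y : Y} (hy : y ∈ φ.total.source) (ℓ : Jet π y) :
    φ.jetOf hy (φ.jetCoord ℓ) = ℓ :=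
  φ.jetCoord_injective hy (φ.jetCoord_jetOf hy _)

theorem jetCoord_translate {y : Y} (ℓ : Jet π y) (σ : VertHom π y) (i : Fin m) (l : Fin n) :
    φ.jetCoord (ℓ.translate σ) i l =
      φ.jetCoord ℓ i l + φ.dy y i (σ (φ.ddx (π.proj y) l)) :=
  map_add (φ.dy y i) (ℓ.1 _) _

/-- Source of the contact forms `dy^i - Φ^i_k dx^k` in the expression of `H_Φ`. -/
theorem dy_vertProj {y : Y} (hy : y ∈ φ.total.source) (ℓ : Jet π y)
    (u : TangentSpace (𝓡 (n + m)) y) (i : Fin m) :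
    φ.dy y i (vertProj ℓ u) = φ.dy y i u - ∑ k, φ.jetCoord ℓ i k * φ.dxY y k u := by
  have h : (vertProj ℓ u : TangentSpace (𝓡 (n + m)) y) =
      u - ℓ.1 (mfderiv (𝓡 (n + m)) (𝓡 n) π.proj y u) := rfl
  rw [h, map_sub, ← φ.sum_dx_ddx (φ.proj_mem y hy) (mfderiv (𝓡 (n + m)) (𝓡 n) π.proj y u)]
  simp only [map_sum, map_smul, smul_eq_mul]
  congr 1
  refine Finset.sum_congr rfl fun k _ => ?_
  rw [mul_comm, φ.dxY_eq hy]
  rfl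

theorem vert_decomp {y : Y} (hy : y ∈ φ.total.source) (v : Vert π y) :
    v = ∑ i, φ.dy y i v • (⟨φ.ddy y i, φ.ddy_mem hy i⟩ : Vert π y) := by
  refine Subtype.ext ?_
  rw [φ.tangent_decomp hy (v : TangentSpace (𝓡 (n + m)) y)]
  have h0 : ∀ l, φ.dxY y l (v : TangentSpace (𝓡 (n + m)) y) = 0 := fun l => by
    rw [φ.dxY_eq hy]
    exact (congrArg (φ.dx (π.proj y) l) v.2).trans (map_zero _)
  simp only [h0, zero_smul, Finset.sum_const_zero, zero_add, Submodule.coe_sum,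
    Submodule.coe_smul, map_sum, map_smul, φ.dy_ddy hy, smul_eq_mul, mul_ite, mul_one, mul_zero,
    Finset.sum_ite_eq, Finset.mem_univ, if_true]

end FibredChart

/-! ### Exterior products of covectors and independence of the frame -/

theorem wedge_apply {n : ℕ} {E : Type*} [AddCommGroup E] [Module ℝ E] [TopologicalSpace E]
    (α : Fin n → E →L[ℝ] ℝ) (u : Fin n → E) :
    wedge α u = Matrix.det (Matrix.of fun i j => α j (u i)) := rfl

namespace FibredChart

variable {π : FibredManifold n m X Y} (φ : FibredChart π)

theorem wedge_dx_ddx {x : X} (hx : x ∈ φ.base.source) : wedge (φ.dx x) (φ.ddx x) = 1 := by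
  rw [wedge_apply, ← Matrix.det_one (n := Fin n) (R := ℝ)]
  congr 1
  ext i j
  simp [φ.dx_ddx hx, Matrix.one_apply, eq_comm]

theorem momCoord_momOf {y : Y} (hy : y ∈ φ.total.source) (P : Fin n → Fin m → ℝ) :
    φ.momCoord (φ.momOf y P) = P := by
  funext l i
  rw [momCoord, dif_pos hy]
  change (∑ l', ∑ i', P l' i' * φ.dy y i' (φ.dx (π.proj y) l (φ.ddx (π.proj y) l') •
    φ.ddy y i)) * wedge (φ.dx (π.proj y)) (φ.ddx (π.proj y)) = P l i
  simp only [φ.wedge_dx_ddx (φ.proj_mem y hy), φ.dx_ddx (φ.proj_mem y hy), map_smul, φ.dy_ddy hy,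
    smul_eq_mul, mul_ite, mul_one, mul_zero, Finset.sum_ite_eq', Finset.sum_ite_eq,
    Finset.mem_univ, if_true]

end FibredChart

/-- `ε` and `e` are dual bases of `V*` and `V`. -/
structure IsDualPair {n : ℕ} {V : Type*} [AddCommGroup V] [Module ℝ V] [TopologicalSpace V]
    (ε : Fin n → V →L[ℝ] ℝ) (e : Fin n → V) : Prop where
  apply_eq : ∀ l k, ε l (e k) = if l = k then 1 else 0
  sum_smul : ∀ w, ∑ l, ε l w • e l = w

section Wedge

variable {n : ℕ} {E V : Type*} [AddCommGroup E] [Module ℝ E] [TopologicalSpace E]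
  [AddCommGroup V] [Module ℝ V] [TopologicalSpace V]

/-- Replacing a factor replaces a column. `Matrix.cramer` is linear in the replaced column, which
supplies the linearity in `θ` used below. -/
theorem wedge_update_apply (α : Fin n → E →L[ℝ] ℝ) (l : Fin n) (θ : E →L[ℝ] ℝ) (u : Fin n → E) :
    wedge (Function.update α l θ) u =
      Matrix.cramer (Matrix.of fun i j => α j (u i)) (fun k => θ (u k)) l := by
  rw [Matrix.cramer_apply, wedge_apply]
  congr 1
  ext i j
  by_cases h : j = l
  · subst h; simp
  · simp [h]

theorem wedge_update_of_ne (α : Fin n → E →L[ℝ] ℝ) {l k : Fin n} (h : k ≠ l) :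
    wedge (Function.update α l (α k)) = 0 := by
  ext u
  rw [wedge_apply]
  exact Matrix.det_zero_of_column_eq h fun i => by simp [h]

theorem IsDualPair.wedge_apply_self {ε : Fin n → V →L[ℝ] ℝ} {e : Fin n → V}
    (h : IsDualPair ε e) : wedge ε e = 1 := by
  rw [wedge_apply, ← Matrix.det_one (n := Fin n) (R := ℝ)]
  congr 1
  ext i j
  simp [h.apply_eq, Matrix.one_apply, eq_comm]

/-- The basis of `V` underlying a dual pair. -/
noncomputable def IsDualPair.basis {ε : Fin n → V →L[ℝ] ℝ} {e : Fin n → V}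
    (h : IsDualPair ε e) : Module.Basis (Fin n) ℝ V :=
  Module.Basis.ofEquivFun
    { toFun := fun w l => ε l w
      invFun := fun c => ∑ l, c l • e l
      map_add' := fun v w => funext fun l => map_add (ε l) v w
      map_smul' := fun c w => funext fun l => map_smul (ε l) c w
      left_inv := h.sum_smul
      right_inv := fun c => funext fun l => by simp [h.apply_eq] }

theorem IsDualPair.coe_basis {ε : Fin n → V →L[ℝ] ℝ} {e : Fin n → V}
    (h : IsDualPair ε e) : ⇑h.basis = e := by
  funext k
  rw [basis, Module.Basis.coe_ofEquivFun]
  change ∑ l, (Pi.single k 1 : Fin n → ℝ) l • e l = e k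
  simp [Pi.single_apply]

theorem IsDualPair.form_eq {ε : Fin n → V →L[ℝ] ℝ} {e : Fin n → V} (h : IsDualPair ε e)
    (D : V [⋀^Fin n]→L[ℝ] ℝ) : D = D e • wedge ε := by
  ext u
  have h1 := DFunLike.congr_fun (D.toAlternatingMap.eq_smul_basis_det h.basis) u
  have h2 := DFunLike.congr_fun ((wedge ε).toAlternatingMap.eq_smul_basis_det h.basis) u
  rw [h.coe_basis] at h1 h2
  have h3 : (wedge ε).toAlternatingMap e = 1 := h.wedge_apply_self
  rw [h3, one_smul] at h2
  exact h1.trans (congrArg (D e * ·) h2.symm)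

/-- Expand each determinant along its replaced column: the cofactor at row `k` is the determinant
with that row replaced by the `l`-th unit row, that is, the `ε`-volume with `k`-th argument `e l`.
The sum thus becomes a contraction over `l`. -/
theorem IsDualPair.sum_wedge_update_apply {ε : Fin n → V →L[ℝ] ℝ} {e : Fin n → V}
    (h : IsDualPair ε e) (d : E →L[ℝ] V) (θ : Fin n → E →L[ℝ] ℝ) (u : Fin n → E) :
    (∑ l, wedge (Function.update (fun k => (ε k).comp d) l (θ l))) u =
      ∑ k, ∑ l, θ l (u k) * wedge ε (Function.update (fun j => d (u j)) k (e l)) := by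
  rw [ContinuousAlternatingMap.sum_apply, Finset.sum_comm]
  refine Finset.sum_congr rfl fun l _ => ?_
  rw [wedge_update_apply, Matrix.cramer_eq_adjugate_mulVec, Matrix.mulVec, dotProduct]
  refine Finset.sum_congr rfl fun k _ => ?_
  rw [mul_comm, Matrix.adjugate_apply, wedge_apply]
  congr 2
  ext i j
  by_cases hi : i = k
  · subst hi; simp [h.apply_eq, Pi.single_apply]
  · simp [hi]

/-- The contraction of a bilinear form on `V* × V` does not depend on the dual bases. -/
theorem IsDualPair.sum_bilin_eq {ε ε' : Fin n → V →L[ℝ] ℝ} {e e' : Fin n → V}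
    (h : IsDualPair ε e) (h' : IsDualPair ε' e') (B : (V →L[ℝ] ℝ) → V → ℝ)
    (hadd : ∀ w α β, B (α + β) w = B α w + B β w) (hsmul : ∀ w (c : ℝ) α, B (c • α) w = c * B α w)
    (hlin : ∀ α, IsLinearMap ℝ (B α)) :
    ∑ l, B (ε l) (e l) = ∑ l, B (ε' l) (e' l) := by
  have hl : ∀ w, IsLinearMap ℝ fun α => B α w := fun w => ⟨hadd w, hsmul w⟩
  have h1 : ∀ l, ε l = ∑ a, ε l (e' a) • ε' a := fun l => by
    ext w
    conv_lhs => rw [← h'.sum_smul w]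
    simp [mul_comm]
  calc ∑ l, B (ε l) (e l) = ∑ l, ∑ a, ε l (e' a) * B (ε' a) (e l) := by
        refine Finset.sum_congr rfl fun l _ => ?_
        conv_lhs => rw [h1 l]
        have := map_sum (hl (e l)).mk' (fun a => ε l (e' a) • ε' a) Finset.univ
        refine this.trans (Finset.sum_congr rfl fun a _ => ?_)
        exact hsmul _ _ _
    _ = ∑ a, B (ε' a) (∑ l, ε l (e' a) • e l) := by
        rw [Finset.sum_comm]
        refine Finset.sum_congr rfl fun a _ => ?_
        have := map_sum (hlin (ε' a)).mk' (fun l => ε l (e' a) • e l) Finset.univ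
        refine Eq.trans (Finset.sum_congr rfl fun l _ => ?_) this.symm
        exact ((hlin (ε' a)).map_smul _ _).symm
    _ = _ := by simp only [h.sum_smul]

end Wedge

theorem isDualPair_frame (x : X) : IsDualPair (coframe (k := n) x) (frame x) where
  apply_eq l k := by
    change (EuclideanSpace.single k (1 : ℝ) : EuclideanSpace ℝ (Fin n)) l = _
    simp
  sum_smul w := by
    have h : ∀ v : EuclideanSpace ℝ (Fin n),
        ∑ l, v l • (EuclideanSpace.single l (1 : ℝ) : EuclideanSpace ℝ (Fin n)) = v := fun v => by
      ext i
      simp [Pi.single_apply]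
    exact h w

variable {π : FibredManifold n m X Y}

theorem FibredChart.isDualPair (φ : FibredChart π) {x : X} (hx : x ∈ φ.base.source) :
    IsDualPair (φ.dx x) (φ.ddx x) :=
  ⟨φ.dx_ddx hx, φ.sum_dx_ddx hx⟩

/-- The form `p^λ_i (dy^i - Φ^i_μ dx^μ) ∧ ω_λ` evaluated on vectors, in a form in which it is
visibly a contraction. -/
theorem IsDualPair.sum_wedge_vert_apply {y : Y}
    {ε : Fin n → TangentSpace (𝓡 n) (π.proj y) →L[ℝ] ℝ}
    {e : Fin n → TangentSpace (𝓡 n) (π.proj y)} (h : IsDualPair ε e) (p : Momentum π y)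
    (ℓ : Jet π y) (θ : Fin n → TangentSpace (𝓡 (n + m)) y →L[ℝ] ℝ)
    (hθ : ∀ l u, θ l u = p ((ε l).smulRight (vertProj ℓ u)) e)
    (u : Fin n → TangentSpace (𝓡 (n + m)) y) :
    (∑ l, wedge (Function.update
      (fun k => (ε k).comp (mfderiv (𝓡 (n + m)) (𝓡 n) π.proj y)) l (θ l))) u =
    ∑ k, ∑ l, p ((ε l).smulRight (vertProj ℓ (u k)))
      (Function.update (fun j => mfderiv (𝓡 (n + m)) (𝓡 n) π.proj y (u j)) k (e l)) := by
  rw [h.sum_wedge_update_apply]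
  refine Finset.sum_congr rfl fun k _ => Finset.sum_congr rfl fun l _ => ?_
  -- A density is its value on `e` times the `ε`-volume. This absorbs the evaluation on `e` hidden
  -- in `θ` and leaves an expression that depends on the bases only through the contraction of `ε l`
  -- with `e l`.
  conv_rhs => rw [h.form_eq (p ((ε l).smulRight (vertProj ℓ (u k))))]
  rw [hθ]
  rfl

theorem smulRight_add_left {E V : Type*} [AddCommGroup E] [Module ℝ E] [TopologicalSpace E]
    [IsTopologicalAddGroup E]
    [AddCommGroup V] [Module ℝ V] [TopologicalSpace V] [IsTopologicalAddGroup V]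
    [ContinuousSMul ℝ V] (α β : E →L[ℝ] ℝ) (v : V) :
    (α + β).smulRight v = α.smulRight v + β.smulRight v := by
  ext w; simp [add_smul]

theorem smulRight_smul_left {E V : Type*} [AddCommGroup E] [Module ℝ E] [TopologicalSpace E]
    [AddCommGroup V] [Module ℝ V] [TopologicalSpace V] [IsTopologicalAddGroup V]
    [ContinuousSMul ℝ V] (c : ℝ) (α : E →L[ℝ] ℝ) (v : V) :
    (c • α).smulRight v = c • α.smulRight v := by
  ext w; simp [mul_smul]

/-- For fixed `k` the contraction is the trace of `(α, w) ↦ p (α ⊗ v)(…, w, …)`, where `v` is the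
vertical part of `u k`. It is bilinear, so its trace is the same for all dual bases, and the frame
in `hamOf` may be exchanged for the coordinate one. -/
theorem hamOf_eq_of_isDualPair (Φ : MomentumMorphism π) {y : Y} (p : Momentum π y)
    {ε : Fin n → TangentSpace (𝓡 n) (π.proj y) →L[ℝ] ℝ}
    {e : Fin n → TangentSpace (𝓡 n) (π.proj y)} (h : IsDualPair ε e)
    (θ : Fin n → TangentSpace (𝓡 (n + m)) y →L[ℝ] ℝ)
    (hθ : ∀ l u, θ l u = p ((ε l).smulRight (vertProj (Φ y p) u)) e) :
    hamOf Φ y p = ∑ l, wedge (Function.update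
      (fun k => (ε k).comp (mfderiv (𝓡 (n + m)) (𝓡 n) π.proj y)) l (θ l)) := by
  ext u
  rw [h.sum_wedge_vert_apply p (Φ y p) θ hθ u]
  refine ((isDualPair_frame (π.proj y)).sum_wedge_vert_apply p (Φ y p) _
    (fun l u => ?_) u).trans ?_
  · rfl
  refine Finset.sum_congr rfl fun k _ => ?_
  refine (isDualPair_frame (π.proj y)).sum_bilin_eq h
    (fun α w => p (α.smulRight (vertProj (Φ y p) (u k)))
      (Function.update (fun j => mfderiv (𝓡 (n + m)) (𝓡 n) π.proj y (u j)) k w))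
    (fun w α β => ?_) (fun w c α => ?_) (fun α => ⟨fun w w' => ?_, fun c w => ?_⟩)
  · simp only [smulRight_add_left, map_add]; rfl
  · simp only [smulRight_smul_left, map_smul]; rfl
  · exact ContinuousAlternatingMap.map_update_add _ _ _ _ _
  · exact ContinuousAlternatingMap.map_update_smul _ _ _ _ _

/-! ### Coordinate expressions of the forms -/

namespace FibredChart

variable (φ : FibredChart π)

theorem momentum_smulRight_vertProj {y : Y} (hy : y ∈ φ.total.source) (p : Momentum π y)
    (ℓ : Jet π y) (l : Fin n) (u : TangentSpace (𝓡 (n + m)) y) :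
    p ((φ.dx (π.proj y) l).smulRight (vertProj ℓ u)) (φ.ddx (π.proj y)) =
      ∑ i, φ.momCoord p l i * (φ.dy y i u - ∑ k, φ.jetCoord ℓ i k * φ.dxY y k u) := by
  have h : (φ.dx (π.proj y) l).smulRight (vertProj ℓ u) =
      ∑ i, (φ.dy y i u - ∑ k, φ.jetCoord ℓ i k * φ.dxY y k u) •
        (φ.dx (π.proj y) l).smulRight (⟨φ.ddy y i, φ.ddy_mem hy i⟩ : Vert π y) := by
    refine ContinuousLinearMap.ext fun w => ?_
    rw [ContinuousLinearMap.smulRight_apply, φ.vert_decomp hy (vertProj ℓ u), Finset.smul_sum,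
      sum_apply]
    refine Finset.sum_congr rfl fun i _ => ?_
    rw [φ.dy_vertProj hy, smul_comm]
    rfl
  rw [h, map_sum, ContinuousAlternatingMap.sum_apply]
  refine Finset.sum_congr rfl fun i _ => ?_
  rw [map_smul, mul_comm, momCoord, dif_pos hy]
  rfl

theorem hamExpr_apply (y : Y) (P : Fin n → Fin m → ℝ) (h : ℝ)
    (u : Fin n → TangentSpace (𝓡 (n + m)) y) :
    φ.hamExpr y P h u = ∑ l, ∑ i, P l i * wedge (Function.update (φ.dxY y) l (φ.dy y i)) u -
      h * wedge (φ.dxY y) u := by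
  simp [hamExpr, ContinuousAlternatingMap.sum_apply]

theorem hamOf_eq (Φ : MomentumMorphism π) {y : Y} (hy : y ∈ φ.total.source) (p : Momentum π y) :
    hamOf Φ y p = φ.hamExpr y (φ.momCoord p)
      (∑ l, ∑ i, φ.momCoord p l i * φ.jetCoord (Φ y p) i l) := by
  have hdx : (fun k => (φ.dx (π.proj y) k).comp (mfderiv (𝓡 (n + m)) (𝓡 n) π.proj y)) =
      φ.dxY y := funext fun k => (φ.dxY_eq hy k).symm
  rw [hamOf_eq_of_isDualPair Φ p (φ.isDualPair (φ.proj_mem y hy))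
    (fun l => ∑ i, φ.momCoord p l i • (φ.dy y i - ∑ k, φ.jetCoord (Φ y p) i k • φ.dxY y k))
    (fun l u => by simp [φ.momentum_smulRight_vertProj hy]), hdx]
  ext u
  rw [hamExpr_apply, ContinuousAlternatingMap.sum_apply, Finset.sum_mul, ← Finset.sum_sub_distrib]
  refine Finset.sum_congr rfl fun l _ => ?_
  rw [wedge_update_apply]
  have h1 : (fun k => (∑ i, φ.momCoord p l i •
      (φ.dy y i - ∑ k, φ.jetCoord (Φ y p) i k • φ.dxY y k)) (u k)) =
      ∑ i, φ.momCoord p l i • ((fun k => φ.dy y i (u k)) -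
        ∑ a, φ.jetCoord (Φ y p) i a • fun k => φ.dxY y a (u k)) := by
    funext k
    simp
  rw [h1, map_sum, Finset.sum_apply, Finset.sum_mul, ← Finset.sum_sub_distrib]
  refine Finset.sum_congr rfl fun i _ => ?_
  rw [map_smul, map_sub, map_sum, Pi.smul_apply, Pi.sub_apply, Finset.sum_apply, smul_eq_mul,
    mul_sub, ← wedge_update_apply, mul_assoc]
  congr 2
  simp only [map_smul, Pi.smul_apply, ← wedge_update_apply, smul_eq_mul]
  -- For `k ≠ l` the covector `dx^k` occurs twice and the product vanishes; for `k = l` nothing has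
  -- been replaced and the product is `ω`.
  rw [Finset.sum_eq_single l (fun k _ hk => by rw [wedge_update_of_ne _ hk]; simp) (by simp),
    Function.update_eq_self]

theorem lagComp_eq (L : Lagrangian π) (Φ : MomentumMorphism π) {y : Y} (hy : y ∈ φ.total.source)
    (p : Momentum π y) :
    lagComp L Φ y p = L y (Φ y p) (φ.ddx (π.proj y)) • wedge (φ.dxY y) := by
  have hdx : φ.dxY y = (fun k => (φ.dx (π.proj y) k).comp
      (mfderiv (𝓡 (n + m)) (𝓡 n) π.proj y)) := funext fun k => φ.dxY_eq hy k
  rw [lagComp, (φ.isDualPair (φ.proj_mem y hy)).form_eq (L y (Φ y p)), hdx]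
  ext u
  simp [(φ.isDualPair (φ.proj_mem y hy)).wedge_apply_self]
  exact Or.inl rfl

theorem affineHam_eq (L : Lagrangian π) (Γ : ∀ y, Jet π y) {y : Y} (hy : y ∈ φ.total.source)
    (p : Momentum π y) :
    affineHam L Γ y p = φ.hamExpr y (φ.momCoord p)
      (∑ l, ∑ i, φ.momCoord p l i * φ.jetCoord (Γ y) i l - L y (Γ y) (φ.ddx (π.proj y))) := by
  rw [affineHam, φ.hamOf_eq _ hy, φ.lagComp_eq L _ hy]
  ext u
  rw [ContinuousAlternatingMap.add_apply, hamExpr_apply, hamExpr_apply,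
    ContinuousAlternatingMap.smul_apply, smul_eq_mul]
  simp only [liftConnection]
  ring

/-- Each `dy^i ∧ ω_λ` has a zero column on `(∂_1, …, ∂_n)`, so the evaluation that defines `ham`
recovers the coefficient of `-ω`. -/
theorem hamExpr_ddxY {y : Y} (hy : y ∈ φ.total.source) (P : Fin n → Fin m → ℝ) (h : ℝ) :
    φ.hamExpr y P h (φ.ddxY y) = - h := by
  have h1 : ∀ l i, wedge (Function.update (φ.dxY y) l (φ.dy y i)) (φ.ddxY y) = 0 := fun l i => by
    rw [wedge_apply]
    refine Matrix.det_eq_zero_of_column_eq_zero l fun j => ?_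
    simp [φ.dy_ddxY hy]
  have h2 : wedge (φ.dxY y) (φ.ddxY y) = 1 := by
    rw [wedge_apply, ← Matrix.det_one (n := Fin n) (R := ℝ)]
    congr 1
    ext i j
    simp [φ.dxY_ddxY hy, Matrix.one_apply, eq_comm]
  simp [hamExpr_apply, h1, h2]

theorem ham_total (H : SemibasicForm π) {y : Y} (hy : y ∈ φ.total.source)
    (P : Fin n → Fin m → ℝ) :
    φ.ham H (φ.total y, P) = - H y (φ.momOf y P) (φ.ddxY y) := by
  unfold ham
  simp only
  rw [φ.total.left_inv hy]

theorem lag_total (L : Lagrangian π) {y : Y} (hy : y ∈ φ.total.source) (ℓ : Jet π y) :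
    φ.lag L (φ.total y, φ.jetCoord ℓ) = L y ℓ (φ.ddx (π.proj y)) := by
  obtain ⟨z, hz, rfl⟩ : ∃ z ∈ φ.total.target, φ.total.symm z = y :=
    ⟨φ.total y, φ.total.map_source hy, φ.total.left_inv hy⟩
  simp only [φ.total.right_inv hz]
  rw [lag, dif_pos hz]
  simp only [φ.jetOf_jetCoord]

theorem ham_affineHam (L : Lagrangian π) (Γ : ∀ y, Jet π y) {y : Y} (hy : y ∈ φ.total.source)
    (P : Fin n → Fin m → ℝ) :
    φ.ham (affineHam L Γ) (φ.total y, P) =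
      ∑ l, ∑ i, P l i * φ.jetCoord (Γ y) i l - φ.lag L (φ.total y, φ.jetCoord (Γ y)) := by
  rw [φ.ham_total _ hy, φ.affineHam_eq L Γ hy, φ.hamExpr_ddxY hy, φ.momCoord_momOf hy,
    φ.lag_total L hy, neg_neg]

theorem affineHam_eq_hamExpr (L : Lagrangian π) (Γ : ∀ y, Jet π y) {y : Y}
    (hy : y ∈ φ.total.source) (p : Momentum π y) :
    affineHam L Γ y p =
      φ.hamExpr y (φ.momCoord p) (φ.ham (affineHam L Γ) (φ.total y, φ.momCoord p)) := by
  rw [φ.ham_affineHam L Γ hy, φ.affineHam_eq L Γ hy, φ.lag_total L hy]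

end FibredChart

/-! ### Existence of fibred coordinates -/

/-- The inverse function theorem, with a smooth inverse on an open set. -/
theorem exists_openPartialHomeomorph_of_injective_fderiv {E F : Type*}
    [NormedAddCommGroup E] [NormedSpace ℝ E] [FiniteDimensional ℝ E]
    [NormedAddCommGroup F] [NormedSpace ℝ F] [FiniteDimensional ℝ F]
    (hEF : Module.finrank ℝ E = Module.finrank ℝ F) {g : E → F} {O : Set E} (hO : IsOpen O)
    (hg : ContDiffOn ℝ ∞ g O) {a : E} (ha : a ∈ O) (hinj : Function.Injective (fderiv ℝ g a)) :
    ∃ G : OpenPartialHomeomorph E F, a ∈ G.source ∧ G.source ⊆ O ∧ ⇑G = g ∧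
      ContDiffOn ℝ ∞ G.symm G.target := by
  have hgat : ∀ z ∈ O, ContDiffAt ℝ ∞ g z := fun z hz => (hg z hz).contDiffAt (hO.mem_nhds hz)
  have := FiniteDimensional.complete ℝ E
  have := FiniteDimensional.complete ℝ F
  let e : E ≃L[ℝ] F := (LinearEquiv.ofInjectiveOfFinrankEq (fderiv ℝ g a).toLinearMap hinj
    hEF).toContinuousLinearEquiv
  have he : (e : E →L[ℝ] F) = fderiv ℝ g a := by ext v; rfl
  have hd : HasFDerivAt g (e : E →L[ℝ] F) a := by
    rw [he]; exact ((hgat a ha).differentiableAt (by simp)).hasFDerivAt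
  let G := (hgat a ha).toOpenPartialHomeomorph g hd (by simp)
  -- The inverse is smooth only where the derivative of `g` is invertible. This is an open
  -- condition, so shrinking the domain to it gives smoothness on the whole target.
  let O' := O ∩ fderiv ℝ g ⁻¹' Set.range ((↑) : (E ≃L[ℝ] F) → E →L[ℝ] F)
  have hO' : IsOpen O' := (hg.continuousOn_fderiv_of_isOpen hO (by simp)).isOpen_inter_preimage hO
    ContinuousLinearEquiv.isOpen
  refine ⟨G.restrOpen O' hO',
    ⟨(hgat a ha).mem_toOpenPartialHomeomorph_source hd (by simp), ha, e, he⟩,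
    fun z hz => hz.2.1, rfl, fun w hw => ?_⟩
  have hw' := (G.restrOpen O' hO').map_target hw
  obtain ⟨-, hz, e', he'⟩ := hw'
  refine ContDiffAt.contDiffWithinAt ?_
  refine (G.restrOpen O' hO').contDiffAt_symm hw (f₀' := e') ?_ (hgat _ hz)
  rw [he']
  exact ((hgat _ hz).differentiableAt (by simp)).hasFDerivAt

/-- Take for `P` a projection onto `ker A`, identified with `ℝᵐ` by rank–nullity: a vector of `ker
A` projects to itself, so `A v = 0` and `P v = 0` force `v = 0`. -/
theorem exists_injective_prod {E F : Type*}
    [NormedAddCommGroup E] [NormedSpace ℝ E] [FiniteDimensional ℝ E]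
    [NormedAddCommGroup F] [NormedSpace ℝ F] [FiniteDimensional ℝ F] {m : ℕ}
    (hEF : Module.finrank ℝ E = Module.finrank ℝ F + m) (A : E →L[ℝ] F)
    (hA : Function.Surjective A) :
    ∃ P : E →L[ℝ] (Fin m → ℝ), Function.Injective (A.prod P) := by
  obtain ⟨q, hq⟩ := LinearMap.exists_leftInverse_of_injective
    (LinearMap.ker A.toLinearMap).subtype (LinearMap.ker_eq_bot.2 Subtype.val_injective)
  have hr := A.toLinearMap.finrank_range_add_finrank_ker
  rw [LinearMap.range_eq_top.2 hA, finrank_top] at hr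
  have hk : Module.finrank ℝ (LinearMap.ker A.toLinearMap) = Module.finrank ℝ (Fin m → ℝ) := by
    rw [Module.finrank_fin_fun]; omega
  let P := (LinearEquiv.ofFinrankEq _ _ hk).toLinearMap.comp q
  refine ⟨LinearMap.toContinuousLinearMap P, (injective_iff_map_eq_zero _).2 fun v hv => ?_⟩
  have h1 : A v = 0 := congrArg Prod.fst hv
  have h2 : LinearEquiv.ofFinrankEq _ _ hk (q v) = 0 := congrArg Prod.snd hv
  rw [map_eq_zero_iff _ (LinearEquiv.injective _)] at h2
  have h3 : q v = ⟨v, h1⟩ := DFunLike.congr_fun hq (⟨v, h1⟩ : LinearMap.ker A.toLinearMap)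
  exact congrArg Subtype.val (h3.symm.trans h2)

/-- Normal form of a submersion: in a chart of `Y` the map `base ∘ π` becomes `f`. Completing `f` by
`m` linear functions `P` makes the derivative of `(f, P)` invertible at the point, and the inverse
function theorem applies. The first component is `base ∘ π` by construction. -/
theorem FibredManifold.exists_fibredChart [IsManifold (𝓡 n) ∞ X] [IsManifold (𝓡 (n + m)) ∞ Y]
    (π : FibredManifold n m X Y) (y₀ : Y) : ∃ φ : FibredChart π, y₀ ∈ φ.total.source := by
  let eX := EuclideanSpace.equiv (Fin n) ℝ
  let cX := chartAt (EuclideanSpace ℝ (Fin n)) (π.proj y₀)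
  let base : OpenPartialHomeomorph X (Fin n → ℝ) := cX.transHomeomorph eX.toHomeomorph
  have base_smooth : ContMDiffOn (𝓡 n) 𝓘(ℝ, Fin n → ℝ) ∞ base base.source :=
    eX.contDiff.contMDiff.comp_contMDiffOn (contMDiffOn_chart (n := ∞))
  have base_symm_smooth : ContMDiffOn 𝓘(ℝ, Fin n → ℝ) (𝓡 n) ∞ base.symm base.target :=
    (contMDiffOn_chart_symm (n := ∞)).comp eX.symm.contDiff.contMDiff.contMDiffOn fun z hz => hz
  let cY := chartAt (EuclideanSpace ℝ (Fin (n + m))) y₀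
  have hU : IsOpen (π.proj ⁻¹' base.source) := base.open_source.preimage π.smooth.continuous
  let eY := cY.restrOpen _ hU
  have eY_smooth : ContMDiffOn (𝓡 (n + m)) (𝓡 (n + m)) ∞ eY eY.source :=
    (contMDiffOn_chart (n := ∞)).mono fun z hz => hz.1
  have eY_symm_smooth : ContMDiffOn (𝓡 (n + m)) (𝓡 (n + m)) ∞ eY.symm eY.target :=
    (contMDiffOn_chart_symm (n := ∞)).mono fun z hz => hz.1
  have hy₀ : y₀ ∈ eY.source := ⟨mem_chart_source _ y₀, mem_chart_source _ (π.proj y₀)⟩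
  let f : EuclideanSpace ℝ (Fin (n + m)) → Fin n → ℝ := fun z => base (π.proj (eY.symm z))
  have hf' : ContMDiffOn (𝓡 (n + m)) 𝓘(ℝ, Fin n → ℝ) ∞ f eY.target :=
    base_smooth.comp (π.smooth.comp_contMDiffOn eY_symm_smooth) fun z hz => (eY.map_target hz).2
  have hf : ContDiffOn ℝ ∞ f eY.target := contMDiffOn_iff_contDiffOn.1 hf'
  have hz₀ := eY.map_source hy₀
  have hsurj : Function.Surjective (fderiv ℝ f (eY y₀)) := by
    have hb₀ : π.proj y₀ ∈ base.source := hy₀.2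
    have hbt := base.map_source hb₀
    have d1 : MDifferentiableAt (𝓡 n) 𝓘(ℝ, Fin n → ℝ) base (π.proj y₀) :=
      ((base_smooth _ hb₀).contMDiffAt (base.open_source.mem_nhds hb₀)).mdifferentiableAt (by simp)
    have d2 : MDifferentiableAt 𝓘(ℝ, Fin n → ℝ) (𝓡 n) base.symm (base (π.proj y₀)) :=
      ((base_symm_smooth _ hbt).contMDiffAt (base.open_target.mem_nhds hbt)).mdifferentiableAt
        (by simp)
    have d3 : MDifferentiableAt (𝓡 (n + m)) (𝓡 (n + m)) eY y₀ :=
      ((eY_smooth _ hy₀).contMDiffAt (eY.open_source.mem_nhds hy₀)).mdifferentiableAt (by simp)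
    have d4 : MDifferentiableAt (𝓡 (n + m)) 𝓘(ℝ, Fin n → ℝ) f (eY y₀) :=
      ((hf' _ hz₀).contMDiffAt (eY.open_target.mem_nhds hz₀)).mdifferentiableAt (by simp)
    have d5 : MDifferentiableAt (𝓡 (n + m)) (𝓡 n) π.proj y₀ :=
      (π.smooth _).mdifferentiableAt (by simp)
    have e1 : base ∘ base.symm =ᶠ[nhds (base (π.proj y₀))] id := by
      filter_upwards [base.open_target.mem_nhds hbt] with z hz
      exact base.right_inv hz
    have h1 := e1.mfderiv_eq (I := 𝓘(ℝ, Fin n → ℝ)) (I' := 𝓘(ℝ, Fin n → ℝ))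
    rw [mfderiv_comp_of_eq d1 d2 (base.left_inv hb₀), mfderiv_id] at h1
    have e2 : f ∘ eY =ᶠ[nhds y₀] base ∘ π.proj := by
      filter_upwards [eY.open_source.mem_nhds hy₀] with z hz
      exact congrArg (fun y => base (π.proj y)) (eY.left_inv hz)
    have h2 := e2.mfderiv_eq (I := 𝓡 (n + m)) (I' := 𝓘(ℝ, Fin n → ℝ))
    rw [mfderiv_comp _ d4 d3, mfderiv_comp _ d1 d5, mfderiv_eq_fderiv] at h2
    intro w
    have h1w := DFunLike.congr_fun h1 w
    -- A preimage of `w` is found by carrying `w` to `TX`, lifting it through `dπ`, and pushing the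
    -- lift into the chart of `Y`.
    obtain ⟨v, hv⟩ := π.submersion y₀
      (mfderiv 𝓘(ℝ, Fin n → ℝ) (𝓡 n) base.symm (base (π.proj y₀)) w)
    refine ⟨mfderiv (𝓡 (n + m)) (𝓡 (n + m)) eY y₀ v, (DFunLike.congr_fun h2 v).trans ?_⟩
    refine Eq.trans ?_ h1w
    change mfderiv (𝓡 n) 𝓘(ℝ, Fin n → ℝ) base (π.proj y₀)
      (mfderiv (𝓡 (n + m)) (𝓡 n) π.proj y₀ v) = _
    rw [hv]
    exact congrArg (fun q => (mfderiv (𝓡 n) 𝓘(ℝ, Fin n → ℝ) base q :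
      EuclideanSpace ℝ (Fin n) →L[ℝ] (Fin n → ℝ))
      (mfderiv 𝓘(ℝ, Fin n → ℝ) (𝓡 n) base.symm (base (π.proj y₀)) w :
        EuclideanSpace ℝ (Fin n))) (base.left_inv hb₀).symm
  obtain ⟨P, hP⟩ := exists_injective_prod (m := m) (by simp) _ hsurj
  have hfd : DifferentiableAt ℝ f (eY y₀) :=
    ((hf _ hz₀).contDiffAt (eY.open_target.mem_nhds hz₀)).differentiableAt (by simp)
  have hgd : fderiv ℝ (fun z => (f z, P z)) (eY y₀) = (fderiv ℝ f (eY y₀)).prod P :=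
    (hfd.hasFDerivAt.prodMk P.hasFDerivAt).fderiv
  obtain ⟨G, haG, hGO, hG, hGs⟩ := exists_openPartialHomeomorph_of_injective_fderiv
    (g := fun z => (f z, P z)) (by simp) eY.open_target (hf.prodMk P.contDiff.contDiffOn) hz₀
    (by rw [hgd]; exact hP)
  refine ⟨⟨base, base_smooth, base_symm_smooth, eY.trans G, ?_, ?_, ?_, ?_⟩, ?_⟩
  · refine ContMDiffOn.comp (t := G.source) ?_ (eY_smooth.mono fun z hz => hz.1) fun z hz => hz.2
    change ContMDiffOn _ _ _ G _
    rw [hG]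
    exact ((hf.prodMk P.contDiff.contDiffOn).mono hGO).contMDiffOn
  · exact eY_symm_smooth.comp (hGs.contMDiffOn.mono fun z hz => hz.1) fun z hz => hz.2
  · exact fun y hy => hy.1.2
  · intro y hy
    change (G (eY y)).1 = _
    rw [hG]
    exact congrArg (fun y => base (π.proj y)) (eY.left_inv hy.1)
  · exact ⟨hy₀, haG⟩

/-! ### Change of fibred coordinates and smoothness of jet coordinates -/

namespace FibredChart

variable {π : FibredManifold n m X Y} (φ ψ : FibredChart π)

theorem total_contMDiffAt {y : Y} (hy : y ∈ φ.total.source) :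
    ContMDiffAt (𝓡 (n + m)) 𝓘(ℝ, (Fin n → ℝ) × (Fin m → ℝ)) ∞ φ.total y :=
  (φ.total_smooth _ hy).contMDiffAt (φ.total.open_source.mem_nhds hy)

theorem base_contMDiffAt {x : X} (hx : x ∈ φ.base.source) :
    ContMDiffAt (𝓡 n) 𝓘(ℝ, Fin n → ℝ) ∞ φ.base x :=
  (φ.base_smooth _ hx).contMDiffAt (φ.base.open_source.mem_nhds hx)

theorem base_symm_contMDiffAt {x : X} (hx : x ∈ φ.base.source) :
    ContMDiffAt 𝓘(ℝ, Fin n → ℝ) (𝓡 n) ∞ φ.base.symm (φ.base x) :=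
  (φ.base_symm_smooth _ (φ.base.map_source hx)).contMDiffAt
    (φ.base.open_target.mem_nhds (φ.base.map_source hx))

theorem total_symm_contMDiffAt {y : Y} (hy : y ∈ φ.total.source) :
    ContMDiffAt 𝓘(ℝ, (Fin n → ℝ) × (Fin m → ℝ)) (𝓡 (n + m)) ∞ φ.total.symm (φ.total y) :=
  (φ.total_symm_smooth _ (φ.total.map_source hy)).contMDiffAt
    (φ.total.open_target.mem_nhds (φ.total.map_source hy))

theorem transition_contDiffAt {y : Y} (hφ : y ∈ φ.total.source) (hψ : y ∈ ψ.total.source) :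
    ContDiffAt ℝ ∞ (φ.total ∘ ψ.total.symm) (ψ.total y) := by
  rw [← contMDiffAt_iff_contDiffAt]
  exact (φ.total_contMDiffAt hφ).comp_of_eq (ψ.total_symm_contMDiffAt hψ) (ψ.total.left_inv hψ)

theorem dtotal_dtotalSymm_eq_fderiv {y : Y} (hφ : y ∈ φ.total.source) (hψ : y ∈ ψ.total.source)
    (w : (Fin n → ℝ) × (Fin m → ℝ)) :
    φ.dtotal y (ψ.dtotalSymm y w) = fderiv ℝ (φ.total ∘ ψ.total.symm) (ψ.total y) w := by
  obtain ⟨z, hz, rfl⟩ : ∃ z ∈ ψ.total.target, ψ.total.symm z = y :=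
    ⟨ψ.total y, ψ.total.map_source hψ, ψ.total.left_inv hψ⟩
  unfold dtotal dtotalSymm
  rw [ψ.total.right_inv hz, ← mfderiv_eq_fderiv,
    mfderiv_comp _ (φ.total_mdifferentiableAt hφ) (ψ.total_symm_mdifferentiableAt hz)]
  rfl

/-- The coordinate vectors of `ψ` live in varying tangent spaces; their components in `φ` are
columns of the Jacobian of the transition map, hence smooth. -/
theorem dtotal_dtotalSymm_contMDiffAt {y : Y} (hφ : y ∈ φ.total.source)
    (hψ : y ∈ ψ.total.source) (w : (Fin n → ℝ) × (Fin m → ℝ)) :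
    ContMDiffAt (𝓡 (n + m)) 𝓘(ℝ, (Fin n → ℝ) × (Fin m → ℝ)) ∞
      (fun y => φ.dtotal y (ψ.dtotalSymm y w)) y := by
  have h1 : ContDiffAt ℝ ∞ (fun z => fderiv ℝ (φ.total ∘ ψ.total.symm) z w) (ψ.total y) :=
    ((φ.transition_contDiffAt ψ hφ hψ).fderiv_right (m := ∞) (by simp)).clm_apply contDiffAt_const
  have h2 := h1.contMDiffAt.comp y (ψ.total_contMDiffAt hψ)
  refine h2.congr_of_eventuallyEq ?_
  filter_upwards [φ.total.open_source.mem_nhds hφ, ψ.total.open_source.mem_nhds hψ] with z h h'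
  exact φ.dtotal_dtotalSymm_eq_fderiv ψ h h' w

theorem dxY_contMDiffAt {y : Y} (hφ : y ∈ φ.total.source) (hψ : y ∈ ψ.total.source)
    (w : (Fin n → ℝ) × (Fin m → ℝ)) (l : Fin n) :
    ContMDiffAt (𝓡 (n + m)) 𝓘(ℝ, ℝ) ∞ (fun y => φ.dxY y l (ψ.dtotalSymm y w)) y :=
  ((ContinuousLinearMap.proj l).comp (ContinuousLinearMap.fst ℝ (Fin n → ℝ)
    (Fin m → ℝ))).contDiff.contMDiff.contMDiffAt.comp y
    (φ.dtotal_dtotalSymm_contMDiffAt ψ hφ hψ w)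

theorem dy_contMDiffAt {y : Y} (hφ : y ∈ φ.total.source) (hψ : y ∈ ψ.total.source)
    (w : (Fin n → ℝ) × (Fin m → ℝ)) (i : Fin m) :
    ContMDiffAt (𝓡 (n + m)) 𝓘(ℝ, ℝ) ∞ (fun y => φ.dy y i (ψ.dtotalSymm y w)) y :=
  ((ContinuousLinearMap.proj i).comp (ContinuousLinearMap.snd ℝ (Fin n → ℝ)
    (Fin m → ℝ))).contDiff.contMDiff.contMDiffAt.comp y
    (φ.dtotal_dtotalSymm_contMDiffAt ψ hφ hψ w)

/-- The transformation law of the jet coordinates. -/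
theorem jetCoord_eq {y : Y} (hφ : y ∈ φ.total.source) (hψ : y ∈ ψ.total.source) (ℓ : Jet π y)
    (i : Fin m) (l : Fin n) :
    φ.jetCoord ℓ i l = ∑ k, ψ.dxY y k (φ.ddxY y l) *
      (φ.dy y i (ψ.ddxY y k) + ∑ j, ψ.jetCoord ℓ j k * φ.dy y i (ψ.ddy y j)) := by
  have h : ∀ k, ψ.dxY y k (φ.ddxY y l) = ψ.dx (π.proj y) k (φ.ddx (π.proj y) l) := fun k => by
    rw [ψ.dxY_eq hψ, ← φ.mfderiv_proj_ddxY hφ]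
    rfl
  rw [jetCoord, ← ψ.sum_dx_ddx (ψ.proj_mem y hψ) (φ.ddx (π.proj y) l)]
  simp only [map_sum, map_smul, ψ.jet_ddx hψ, map_add, smul_eq_mul, h]

/-- The transformation law is affine in the jet coordinates with smooth coefficients, so smoothness
of a jet field at a point need only be checked in one chart. -/
theorem jetCoord_contMDiffAt_change {Γ : ∀ y, Jet π y} {y : Y} (hφ : y ∈ φ.total.source)
    (hψ : y ∈ ψ.total.source)
    (h : ∀ i l, ContMDiffAt (𝓡 (n + m)) 𝓘(ℝ, ℝ) ∞ (fun y => ψ.jetCoord (Γ y) i l) y)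
    (i : Fin m) (l : Fin n) :
    ContMDiffAt (𝓡 (n + m)) 𝓘(ℝ, ℝ) ∞ (fun y => φ.jetCoord (Γ y) i l) y := by
  have h1 : ContMDiffAt (𝓡 (n + m)) 𝓘(ℝ, ℝ) ∞ (fun y => ∑ k, ψ.dxY y k (φ.ddxY y l) *
      (φ.dy y i (ψ.ddxY y k) + ∑ j, ψ.jetCoord (Γ y) j k * φ.dy y i (ψ.ddy y j))) y :=
    contMDiffAt_finsetSum fun k _ => (ψ.dxY_contMDiffAt φ hψ hφ _ k).mul
      ((φ.dy_contMDiffAt ψ hφ hψ _ i).add (contMDiffAt_finsetSum fun j _ =>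
        (h j k).mul (φ.dy_contMDiffAt ψ hφ hψ _ i)))
  refine h1.congr_of_eventuallyEq ?_
  filter_upwards [φ.total.open_source.mem_nhds hφ, ψ.total.open_source.mem_nhds hψ] with z hz hz'
  exact φ.jetCoord_eq ψ hz hz' _ i l

theorem coord_section_contMDiffAt {s : X → Y} (hs : IsSection π s) {x : X}
    (hx : s x ∈ φ.total.source) (i : Fin m) :
    ContMDiffAt (𝓡 n) 𝓘(ℝ, ℝ) ∞ (fun x' => (φ.total (s x')).2 i) x :=
  ((ContinuousLinearMap.proj i).comp (ContinuousLinearMap.snd ℝ (Fin n → ℝ)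
    (Fin m → ℝ))).contDiff.contMDiff.contMDiffAt.comp x
    ((φ.total_contMDiffAt hx).comp x (hs.smooth x))

theorem pd_contMDiffAt {f : X → ℝ} {x : X} (hx : x ∈ φ.base.source)
    (hf : ContMDiffAt (𝓡 n) 𝓘(ℝ, ℝ) ∞ f x) (l : Fin n) :
    ContMDiffAt (𝓡 n) 𝓘(ℝ, ℝ) ∞ (φ.pd f l) x := by
  have h1 : ContDiffAt ℝ ∞ (f ∘ φ.base.symm) (φ.base x) := by
    rw [← contMDiffAt_iff_contDiffAt]
    exact hf.comp_of_eq (φ.base_symm_contMDiffAt hx) (φ.base.left_inv hx)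
  have h2 : ContDiffAt ℝ ∞ (fun z => fderiv ℝ (f ∘ φ.base.symm) z (Pi.single l 1)) (φ.base x) :=
    (h1.fderiv_right (m := ∞) (by simp)).clm_apply contDiffAt_const
  exact h2.contMDiffAt.comp x (φ.base_contMDiffAt hx)

theorem pd_eq_mfderiv {f : X → ℝ} {x : X} (hx : x ∈ φ.base.source)
    (hf : MDifferentiableAt (𝓡 n) 𝓘(ℝ, ℝ) f x) (l : Fin n) :
    φ.pd f l x = mfderiv (𝓡 n) 𝓘(ℝ, ℝ) f x (φ.ddx x l) := by
  obtain ⟨z, hz, rfl⟩ : ∃ z ∈ φ.base.target, φ.base.symm z = x :=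
    ⟨φ.base x, φ.base.map_source hx, φ.base.left_inv hx⟩
  unfold pd ddx dbaseSymm
  rw [φ.base.right_inv hz, ← mfderiv_eq_fderiv,
    mfderiv_comp _ hf (φ.base_symm_mdifferentiableAt hz)]
  rfl

theorem section_mem_base {s : X → Y} (hs : IsSection π s) {x : X} (hx : s x ∈ φ.total.source) :
    x ∈ φ.base.source := by
  have h := φ.proj_mem _ hx
  rwa [hs.proj_eq] at h

/-- Through this identity the equations `∂_λ s^i = …` of Hamilton and of Euler–Lagrange become
equalities of jets. -/
theorem pd_section {s : X → Y} (hs : IsSection π s) {x : X} (hx : s x ∈ φ.total.source)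
    (i : Fin m) (l : Fin n) :
    φ.pd (fun x' => (φ.total (s x')).2 i) l x = φ.jetCoord (jetProlongation hs x).2 i l := by
  rw [φ.pd_eq_mfderiv (φ.section_mem_base hs hx)
    ((φ.coord_section_contMDiffAt hs hx i).mdifferentiableAt (by simp))]
  have d1 := φ.total_mdifferentiableAt hx
  have d2 : MDifferentiableAt (𝓡 n) (𝓡 (n + m)) s x := (hs.smooth x).mdifferentiableAt (by simp)
  let A : (Fin n → ℝ) × (Fin m → ℝ) →L[ℝ] ℝ :=
    (ContinuousLinearMap.proj i).comp (ContinuousLinearMap.snd ℝ (Fin n → ℝ) (Fin m → ℝ))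
  have h : mfderiv (𝓡 n) 𝓘(ℝ, ℝ) (fun x' => (φ.total (s x')).2 i) x =
      A.comp ((φ.dtotal (s x)).comp (mfderiv (𝓡 n) (𝓡 (n + m)) s x)) :=
    ((A.hasMFDerivAt.comp (f := φ.total ∘ s) x (d1.hasMFDerivAt.comp x d2.hasMFDerivAt))).mfderiv
  rw [h]
  change φ.dy (s x) i (mfderiv (𝓡 n) (𝓡 (n + m)) s x (φ.ddx x l)) =
    φ.dy (s x) i (mfderiv (𝓡 n) (𝓡 (n + m)) s x (φ.ddx (π.proj (s x)) l))
  rw [hs.proj_eq]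

theorem jetCoord_prolongation_contMDiffAt {s : X → Y} (hs : IsSection π s) {x : X}
    (hx : s x ∈ φ.total.source) (i : Fin m) (l : Fin n) :
    ContMDiffAt (𝓡 n) 𝓘(ℝ, ℝ) ∞ (fun x => φ.jetCoord (jetProlongation hs x).2 i l) x := by
  refine (φ.pd_contMDiffAt (φ.section_mem_base hs hx) (φ.coord_section_contMDiffAt hs hx i)
    l).congr_of_eventuallyEq ?_
  filter_upwards [(φ.total.open_source.preimage hs.smooth.continuous).mem_nhds hx] with x' hx'
  exact (φ.pd_section hs hx' i l).symm

end FibredChart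

/-! ### A connection through a given section -/

section Connection

variable {π : FibredManifold n m X Y}

/-- Jets form an affine space: affine combinations of jets. -/
noncomputable def Jet.affineComb {y : Y} {ι : Type*} (I : Finset ι) (c : ι → ℝ)
    (hc : ∑ i ∈ I, c i = 1) (ℓ : ι → Jet π y) : Jet π y :=
  ⟨∑ i ∈ I, c i • (ℓ i).1, fun w => by
    rw [sum_apply, map_sum]
    simp only [smul_apply, map_smul]
    refine (Finset.sum_congr rfl fun i _ => congrArg (c i • ·) ((ℓ i).2 w)).trans ?_
    rw [← Finset.sum_smul, hc, one_smul]⟩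

theorem FibredChart.jetCoord_affineComb (φ : FibredChart π) {y : Y} {ι : Type*} (I : Finset ι)
    (c : ι → ℝ) (hc : ∑ i ∈ I, c i = 1) (ℓ : ι → Jet π y) (i : Fin m) (l : Fin n) :
    φ.jetCoord (Jet.affineComb I c hc ℓ) i l = ∑ a ∈ I, c a • φ.jetCoord (ℓ a) i l := by
  simp only [jetCoord, Jet.affineComb, sum_apply, smul_apply, map_sum, map_smul]

theorem Jet.affineComb_const {y : Y} {ι : Type*} (I : Finset ι) (c : ι → ℝ)
    (hc : ∑ i ∈ I, c i = 1) (ℓ : ι → Jet π y) (J : Jet π y) (h : ∀ a ∈ I, ℓ a = J) :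
    Jet.affineComb I c hc ℓ = J := by
  refine Subtype.ext ?_
  change ∑ a ∈ I, c a • (ℓ a).1 = J.1
  rw [Finset.sum_congr rfl fun a ha => by rw [h a ha], ← Finset.sum_smul, hc, one_smul]

instance Jet.instNonempty [IsManifold (𝓡 n) ∞ X] [IsManifold (𝓡 (n + m)) ∞ Y] (y : Y) :
    Nonempty (Jet π y) := by
  obtain ⟨φ, hφ⟩ := π.exists_fibredChart y
  exact ⟨φ.jetOf hφ 0⟩

/-- The connection `Γ` is of class `C^∞` at `y`. -/
def IsConnectionAt (π : FibredManifold n m X Y) (Γ : ∀ y, Jet π y) (y : Y) : Prop :=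
  ∀ φ : FibredChart π, y ∈ φ.total.source → ∀ i l,
    ContMDiffAt (𝓡 (n + m)) 𝓘(ℝ, ℝ) ∞ (fun y => φ.jetCoord (Γ y) i l) y

theorem isConnection_of_forall_at {Γ : ∀ y, Jet π y} (h : ∀ y, IsConnectionAt π Γ y) :
    IsConnection π Γ :=
  fun φ i l y hy => (h y φ hy i l).contMDiffWithinAt

open Classical in
/-- The jet field with given jet coordinates in the chart `φ`. -/
noncomputable def FibredChart.jetField [IsManifold (𝓡 n) ∞ X] [IsManifold (𝓡 (n + m)) ∞ Y]
    (φ : FibredChart π) (v : Y → Fin m → Fin n → ℝ) (y : Y) : Jet π y :=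
  if h : y ∈ φ.total.source then φ.jetOf h (v y) else Classical.arbitrary _

variable [IsManifold (𝓡 n) ∞ X] [IsManifold (𝓡 (n + m)) ∞ Y]

theorem FibredChart.jetCoord_jetField (φ : FibredChart π) (v : Y → Fin m → Fin n → ℝ) {y : Y}
    (hy : y ∈ φ.total.source) : φ.jetCoord (φ.jetField v y) = v y := by
  rw [jetField, dif_pos hy, φ.jetCoord_jetOf hy]

theorem FibredChart.isConnectionAt_jetField (φ : FibredChart π) {v : Y → Fin m → Fin n → ℝ} {y : Y}
    (hy : y ∈ φ.total.source)
    (hv : ∀ i l, ContMDiffAt (𝓡 (n + m)) 𝓘(ℝ, ℝ) ∞ (fun y => v y i l) y) :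
    IsConnectionAt π (φ.jetField v) y := fun χ hχ => by
  refine χ.jetCoord_contMDiffAt_change φ hχ hy fun i l => (hv i l).congr_of_eventuallyEq ?_
  filter_upwards [φ.total.open_source.mem_nhds hy] with z hz
  rw [φ.jetCoord_jetField v hz]

/-- The image of `s` is `{y | s (π y) = y}`, closed because `Y` is Hausdorff. Off it the zero jet
field of a chart will do; near it `y` receives the jet coordinates that `J¹s` has at `s (π y)`. -/
theorem exists_local_connection [T2Space Y] {s : X → Y} (hs : IsSection π s) (y₀ : Y) :
    ∃ (U : Set Y) (Γ : ∀ y, Jet π y), IsOpen U ∧ y₀ ∈ U ∧ (∀ y ∈ U, IsConnectionAt π Γ y) ∧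
      ∀ x, s x ∈ U → Γ (s x) = (jetProlongation hs x).2 := by
  obtain ⟨φ, hφ⟩ := π.exists_fibredChart y₀
  have hsπ : Continuous fun y => s (π.proj y) := hs.smooth.continuous.comp π.smooth.continuous
  by_cases h : s (π.proj y₀) = y₀
  -- Both `y` and `s (π y)` must lie in the chart: the first carries the jet being defined, the
  -- second the coordinates being copied.
  · refine ⟨φ.total.source ∩ (fun y => s (π.proj y)) ⁻¹' φ.total.source,
      φ.jetField fun y => φ.jetCoord (jetProlongation hs (π.proj y)).2,
      φ.total.open_source.inter (φ.total.open_source.preimage hsπ), ⟨hφ, ?_⟩, fun y hy => ?_,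
      fun x hx => ?_⟩
    · rwa [Set.mem_preimage, h]
    · exact φ.isConnectionAt_jetField hy.1 fun i l =>
        (φ.jetCoord_prolongation_contMDiffAt hs hy.2 i l).comp y (π.smooth y)
    · refine φ.jetCoord_injective hx.1 ?_
      rw [φ.jetCoord_jetField _ hx.1, hs.proj_eq]
      rfl
  · refine ⟨φ.total.source ∩ {y | s (π.proj y) ≠ y}, φ.jetField fun _ => 0,
      φ.total.open_source.inter (isOpen_ne_fun hsπ continuous_id), ⟨hφ, h⟩, fun y hy => ?_,
      fun x hx => absurd (congrArg s (hs.proj_eq x)) hx.2⟩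
    exact φ.isConnectionAt_jetField hy.1 fun i l => contMDiffAt_const

/-- Every section is an integral section of a connection. -/
theorem exists_connection [T2Space Y] [SecondCountableTopology Y] {s : X → Y}
    (hs : IsSection π s) :
    ∃ Γ : ∀ y, Jet π y, IsConnection π Γ ∧ ∀ x, Γ (s x) = (jetProlongation hs x).2 := by
  choose U Γ₀ hU hmem hsm hsec using exists_local_connection hs
  have : LocallyCompactSpace Y :=
    ChartedSpace.locallyCompactSpace (EuclideanSpace ℝ (Fin (n + m))) Y
  obtain ⟨ρ, hρ⟩ := SmoothPartitionOfUnity.exists_isSubordinate (𝓡 (n + m)) isClosed_univ U hU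
    fun y _ => Set.mem_iUnion.2 ⟨y, hmem y⟩
  -- The weights of the partition of unity sum to `1`, so the combination is again a right inverse
  -- of `dπ`.
  refine ⟨fun y => Jet.affineComb (ρ.finsupport y) (fun a => ρ a y)
    (ρ.sum_finsupport y (Set.mem_univ y)) fun a => Γ₀ a y, ?_, fun x => ?_⟩
  · refine isConnection_of_forall_at fun y φ hy i l => ?_
    simp only [φ.jetCoord_affineComb]
    have h : ∀ y, ∑ a ∈ ρ.finsupport y, ρ a y • φ.jetCoord (Γ₀ a y) i l =
        ∑ᶠ a, ρ a y • φ.jetCoord (Γ₀ a y) i l := fun y =>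
      ρ.sum_finsupport_smul_eq_finsum y fun a y => φ.jetCoord (Γ₀ a y) i l
    simp only [h]
    exact ρ.contMDiffAt_finsum fun a ha => hsm a y (hρ a ha) φ hy i l
  -- At `s x` every local connection with non-zero weight already equals `J¹s`, so gluing preserves
  -- the value.
  · exact Jet.affineComb_const _ _ _ _ _ fun a ha =>
      hsec a x (hρ a (subset_tsupport _ ((ρ.mem_finsupport _).1 ha)))

end Connection

/-! ### The Legendre morphism of an affine Lagrangian -/

section Affine

variable {π : FibredManifold n m X Y}

instance VertHom.instFiniteDimensional (y : Y) : FiniteDimensional ℝ (VertHom π y) :=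
  FiniteDimensional.of_injective
    (ContinuousLinearMap.coeLM ℝ : VertHom π y →ₗ[ℝ] TangentSpace (𝓡 n) (π.proj y) →ₗ[ℝ] Vert π y)
    ContinuousLinearMap.coe_injective

/-- In jet coordinates the translation adds `σ^i_λ`, so the increment of `ℒ` is `b^λ_i σ^i_λ`,
exactly linear in `σ`. -/
theorem translate_of_affine (φ : FibredChart π) {L : Lagrangian π}
    {b : (Fin n → ℝ) × (Fin m → ℝ) → Fin n → Fin m → ℝ} {c : (Fin n → ℝ) × (Fin m → ℝ) → ℝ}
    (hbc : HasAffineExpr L φ b c) {y : Y} (hy : y ∈ φ.total.source) (ℓ : Jet π y)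
    (σ : VertHom π y) :
    L y (ℓ.translate σ) = L y ℓ + φ.momOf y (b (φ.total y)) σ := by
  have hd := φ.isDualPair (φ.proj_mem y hy)
  rw [hd.form_eq (L y (ℓ.translate σ)), hd.form_eq (L y ℓ), ← φ.lag_total L hy, ← φ.lag_total L hy,
    hbc _ (φ.total.map_source hy), hbc _ (φ.total.map_source hy)]
  change _ = _ + (∑ l, ∑ i, b (φ.total y) l i * φ.dy y i (σ (φ.ddx (π.proj y) l))) •
    wedge (φ.dx (π.proj y))
  rw [← add_smul]
  congr 1
  simp only [φ.jetCoord_translate, mul_add, Finset.sum_add_distrib]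
  ring

/-- The Legendre morphism of an affine Lagrangian density is constant on the fibres of
`J¹Y → Y`. -/
theorem legendre_of_affine (φ : FibredChart π) {L : Lagrangian π}
    {b : (Fin n → ℝ) × (Fin m → ℝ) → Fin n → Fin m → ℝ} {c : (Fin n → ℝ) × (Fin m → ℝ) → ℝ}
    (hbc : HasAffineExpr L φ b c) {y : Y} (hy : y ∈ φ.total.source) (ℓ : Jet π y) :
    legendre L ℓ = φ.momOf y (b (φ.total y)) := by
  have hA : Continuous (φ.momOf y (b (φ.total y))) :=
    LinearMap.continuous_of_finiteDimensional _
  let A : VertHom π y →L[ℝ] Dens n (π.proj y) := ⟨φ.momOf y (b (φ.total y)), hA⟩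
  have h : HasFDerivAt (fun σ : VertHom π y => L y (ℓ.translate σ)) A 0 := by
    have h1 : (fun σ : VertHom π y => L y (ℓ.translate σ)) = fun σ => L y ℓ + A σ :=
      funext fun σ => translate_of_affine φ hbc hy ℓ σ
    -- The remainder is identically zero, so the topological-vector-space form of the derivative
    -- suffices and no norm has to be estimated.
    rw [h1, hasFDerivAt_iff_isLittleOTVS]
    simp only [map_sub, add_sub_add_left_eq_sub, sub_self]
    exact Asymptotics.IsLittleOTVS.zero _ _
  rw [legendre, h.fderiv]

variable [IsManifold (𝓡 n) ∞ X] [IsManifold (𝓡 (n + m)) ∞ Y]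

/-- Source of both `L̂ ∘ Ĥ = Id` on `Q` and semiregularity. -/
theorem legendre_eq_of_affine {L : Lagrangian π} (hA : IsAffineLagrangian L) {y : Y}
    (ℓ ℓ' : Jet π y) : legendre L ℓ = legendre L ℓ' := by
  obtain ⟨φ, hφ⟩ := π.exists_fibredChart y
  obtain ⟨b, c, hbc⟩ := hA φ
  rw [legendre_of_affine φ hbc hφ, legendre_of_affine φ hbc hφ]

theorem isEmbeddedSubmanifold_univ {E : Type*} [NormedAddCommGroup E] [NormedSpace ℝ E] :
    IsEmbeddedSubmanifold (Set.univ : Set E) := fun _ _ =>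
  ⟨OpenPartialHomeomorph.refl E, ⊤, Set.mem_univ _, contDiffOn_id, contDiffOn_id, by simp⟩

theorem isSemiregular_of_affine {L : Lagrangian π} (hA : IsAffineLagrangian L) :
    IsSemiregular L := by
  rintro φ y hy q ⟨ℓ₀, rfl⟩
  have h : (fun ℓ : Jet π y => φ.jetCoord ℓ) '' {ℓ | legendre L ℓ = legendre L ℓ₀} = Set.univ :=
    Set.eq_univ_of_forall fun v =>
      ⟨φ.jetOf hy v, legendre_eq_of_affine hA _ _, φ.jetCoord_jetOf hy v⟩
  rw [h]
  exact ⟨isConnected_univ, isEmbeddedSubmanifold_univ⟩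

end Affine

/-! ### Derivatives of `ℒ` and `ℋ` -/

theorem fderiv_apply_of_affine_line {E : Type*} [NormedAddCommGroup E] [NormedSpace ℝ E]
    {f : E → ℝ} {a v : E} (hf : DifferentiableAt ℝ f a) {d : ℝ}
    (h : ∀ t : ℝ, f (a + t • v) = f a + t * d) : fderiv ℝ f a v = d := by
  have h1 : HasLineDerivAt ℝ f (fderiv ℝ f a v) a v := hf.hasFDerivAt.hasLineDerivAt v
  have h2 : HasLineDerivAt ℝ f d a v := by
    unfold HasLineDerivAt
    simp only [h]
    simpa using ((hasDerivAt_id (0 : ℝ)).mul_const d).const_add (f a)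
  exact HasDerivAt.unique h1 h2

namespace FibredChart

variable {π : FibredManifold n m X Y} (φ : FibredChart π)

theorem lag_contDiffAt {L : Lagrangian π} (hL : IsSmoothLagrangian L)
    {z : (Fin n → ℝ) × (Fin m → ℝ)} (hz : z ∈ φ.total.target) (v : Fin m → Fin n → ℝ) :
    ContDiffAt ℝ ∞ (φ.lag L) (z, v) :=
  (hL φ (z, v) ⟨hz, trivial⟩).contDiffAt
    ((φ.total.open_target.prod isOpen_univ).mem_nhds ⟨hz, trivial⟩)

/-- The coefficients are values of `ℒ` at constant velocities: `c = ℒ(·, 0)`, and `b^λ_i` is the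
difference of `ℒ(·, E)` and `ℒ(·, 0)`, with `E` the unit velocity in the direction `y^i_λ`. -/
theorem coeff_contDiffAt {L : Lagrangian π} (hL : IsSmoothLagrangian L)
    {b : (Fin n → ℝ) × (Fin m → ℝ) → Fin n → Fin m → ℝ} {c : (Fin n → ℝ) × (Fin m → ℝ) → ℝ}
    (hbc : HasAffineExpr L φ b c) {z : (Fin n → ℝ) × (Fin m → ℝ)} (hz : z ∈ φ.total.target) :
    ContDiffAt ℝ ∞ c z ∧ ∀ l i, ContDiffAt ℝ ∞ (fun z => b z l i) z := by
  have h : ∀ v, ContDiffAt ℝ ∞ (fun z => φ.lag L (z, v)) z := fun v =>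
    (φ.lag_contDiffAt hL hz v).comp z (contDiffAt_id.prodMk contDiffAt_const)
  have hev := φ.total.open_target.mem_nhds hz
  refine ⟨(h 0).congr_of_eventuallyEq ?_, fun l i =>
    ((h (Pi.single i (Pi.single l 1))).sub (h 0)).congr_of_eventuallyEq ?_⟩
  · filter_upwards [hev] with z' hz'
    simp [hbc z' hz']
  · filter_upwards [hev] with z' hz'
    rw [hbc z' hz', hbc z' hz', Finset.sum_eq_single l, Finset.sum_eq_single i]
    · simp
    · intro j _ hj
      simp [hj]
    · simp
    · intro k _ hk
      refine Finset.sum_eq_zero fun j _ => ?_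
      by_cases hj : j = i
      · subst hj; simp [hk]
      · simp [hj]
    · simp

theorem lagMomentum_of_affine {L : Lagrangian π} (hL : IsSmoothLagrangian L)
    {b : (Fin n → ℝ) × (Fin m → ℝ) → Fin n → Fin m → ℝ} {c : (Fin n → ℝ) × (Fin m → ℝ) → ℝ}
    (hbc : HasAffineExpr L φ b c) {z : (Fin n → ℝ) × (Fin m → ℝ)} (hz : z ∈ φ.total.target)
    (v : Fin m → Fin n → ℝ) (l : Fin n) (i : Fin m) :
    φ.lagMomentum L l i (z, v) = b z l i := by
  refine fderiv_apply_of_affine_line ((φ.lag_contDiffAt hL hz v).differentiableAt (by simp))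
    fun t => ?_
  rw [Prod.smul_mk, Prod.mk_add_mk, smul_zero, add_zero, hbc z hz, hbc z hz]
  have h : ∑ k, ∑ j, b z k j * (t • (Pi.single i (Pi.single l 1) : Fin m → Fin n → ℝ)) j k =
      t * b z l i := by
    rw [Finset.sum_eq_single l, Finset.sum_eq_single i]
    · simp [mul_comm]
    · intro j _ hj
      simp [hj]
    · simp
    · intro k _ hk
      refine Finset.sum_eq_zero fun j _ => ?_
      by_cases hj : j = i
      · subst hj; simp [hk]
      · simp [hj]
    · simp
  simp only [Pi.add_apply, mul_add, Finset.sum_add_distrib, h]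
  ring

/-- The momentum is a function on `Y` alone, so the terms with `∂_λ t^j_μ` drop out of the
Euler–Lagrange equations. -/
theorem fderiv_lagMomentum_of_affine {L : Lagrangian π} (hL : IsSmoothLagrangian L)
    {b : (Fin n → ℝ) × (Fin m → ℝ) → Fin n → Fin m → ℝ} {c : (Fin n → ℝ) × (Fin m → ℝ) → ℝ}
    (hbc : HasAffineExpr L φ b c) {z : (Fin n → ℝ) × (Fin m → ℝ)} (hz : z ∈ φ.total.target)
    (v : Fin m → Fin n → ℝ) (l : Fin n) (i : Fin m)
    (w : ((Fin n → ℝ) × (Fin m → ℝ)) × (Fin m → Fin n → ℝ)) :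
    fderiv ℝ (φ.lagMomentum L l i) (z, v) w = fderiv ℝ (fun z => b z l i) z w.1 := by
  have h1 : φ.lagMomentum L l i =ᶠ[nhds (z, v)] (fun z => b z l i) ∘ Prod.fst := by
    filter_upwards [(φ.total.open_target.prod isOpen_univ).mem_nhds ⟨hz, Set.mem_univ v⟩]
      with a ha
    exact φ.lagMomentum_of_affine hL hbc ha.1 a.2 l i
  have hb : DifferentiableAt ℝ (fun z => b z l i) z :=
    ((φ.coeff_contDiffAt hL hbc hz).2 l i).differentiableAt (by simp)
  rw [h1.fderiv_eq, fderiv_comp _ hb differentiableAt_fst, fderiv_fst]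
  rfl

theorem pd_congr {f g : X → ℝ} {x : X} (hx : x ∈ φ.base.source) (h : f =ᶠ[nhds x] g)
    (l : Fin n) : φ.pd f l x = φ.pd g l x := by
  have h1 : f ∘ φ.base.symm =ᶠ[nhds (φ.base x)] g ∘ φ.base.symm := by
    have ht : Filter.Tendsto φ.base.symm (nhds (φ.base x)) (nhds x) := by
      have := φ.base.continuousAt_symm (φ.base.map_source hx)
      rwa [ContinuousAt, φ.base.left_inv hx] at this
    exact ht.eventually h
  rw [pd, pd, h1.fderiv_eq]

/-- The chain rule for the restriction of a function of the coordinates to a section. -/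
theorem pd_comp_section {s : X → Y} (hs : IsSection π s) {x : X} (hx : s x ∈ φ.total.source)
    {B : (Fin n → ℝ) × (Fin m → ℝ) → ℝ} (hB : DifferentiableAt ℝ B (φ.total (s x))) (l : Fin n) :
    φ.pd (fun x' => B (φ.total (s x'))) l x =
      fderiv ℝ B (φ.total (s x)) (Pi.single l 1, 0) +
        ∑ j, φ.jetCoord (jetProlongation hs x).2 j l *
          fderiv ℝ B (φ.total (s x)) (0, Pi.single j 1) := by
  have d1 := φ.total_mdifferentiableAt hx
  have d2 : MDifferentiableAt (𝓡 n) (𝓡 (n + m)) s x := (hs.smooth x).mdifferentiableAt (by simp)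
  have hd := hB.hasFDerivAt.hasMFDerivAt.comp (f := φ.total ∘ s) x
    (d1.hasMFDerivAt.comp x d2.hasMFDerivAt)
  refine (φ.pd_eq_mfderiv (φ.section_mem_base hs hx) hd.mdifferentiableAt l).trans ?_
  have h2 : φ.dtotal (s x) ((jetProlongation hs x).2.1 (φ.ddx (π.proj (s x)) l)) =
      (Pi.single l 1, 0) + ∑ j, φ.jetCoord (jetProlongation hs x).2 j l •
        ((0, Pi.single j 1) : (Fin n → ℝ) × (Fin m → ℝ)) := by
    refine (congrArg (φ.dtotal (s x)) (φ.jet_ddx hx (jetProlongation hs x).2 l)).trans ?_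
    simp only [map_add, map_sum, map_smul, ddxY, ddy, φ.dtotal_dtotalSymm hx]
    rfl
  have h3 : mfderiv (𝓡 n) 𝓘(ℝ, ℝ) (fun x' => B (φ.total (s x'))) x (φ.ddx x l) =
      fderiv ℝ B (φ.total (s x))
        (φ.dtotal (s x) ((jetProlongation hs x).2.1 (φ.ddx (π.proj (s x)) l))) := by
    refine (DFunLike.congr_fun hd.mfderiv (φ.ddx x l)).trans ?_
    change fderiv ℝ B (φ.total (s x)) (φ.dtotal (s x)
      (mfderiv (𝓡 n) (𝓡 (n + m)) s x (φ.ddx x l))) = fderiv ℝ B (φ.total (s x)) (φ.dtotal (s x)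
      (mfderiv (𝓡 n) (𝓡 (n + m)) s x (φ.ddx (π.proj (s x)) l)))
    rw [hs.proj_eq]
  refine h3.trans ?_
  rw [h2]
  simp only [map_add, map_sum, map_smul, smul_eq_mul]
  rfl

/-- The jet coordinates of a connection as functions of the coordinates of `Y`. -/
noncomputable def connCoeff (Γ : ∀ y, Jet π y) (z : (Fin n → ℝ) × (Fin m → ℝ)) :
    Fin m → Fin n → ℝ :=
  φ.jetCoord (Γ (φ.total.symm z))

theorem connCoeff_total (Γ : ∀ y, Jet π y) {y : Y} (hy : y ∈ φ.total.source) :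
    φ.connCoeff Γ (φ.total y) = φ.jetCoord (Γ y) := by
  rw [connCoeff, φ.total.left_inv hy]

theorem connCoeff_contDiffAt {Γ : ∀ y, Jet π y} (hΓ : IsConnection π Γ)
    {z : (Fin n → ℝ) × (Fin m → ℝ)} (hz : z ∈ φ.total.target) (i : Fin m) (l : Fin n) :
    ContDiffAt ℝ ∞ (fun z => φ.connCoeff Γ z i l) z := by
  have hy := φ.total.map_target hz
  rw [← contMDiffAt_iff_contDiffAt]
  exact ((hΓ φ i l _ hy).contMDiffAt (φ.total.open_source.mem_nhds hy)).comp z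
    ((φ.total_symm_smooth _ hz).contMDiffAt (φ.total.open_target.mem_nhds hz))

theorem ham_affineHam_of_mem (L : Lagrangian π) (Γ : ∀ y, Jet π y)
    {z : (Fin n → ℝ) × (Fin m → ℝ)} (hz : z ∈ φ.total.target) (P : Fin n → Fin m → ℝ) :
    φ.ham (affineHam L Γ) (z, P) =
      ∑ l, ∑ i, P l i * φ.connCoeff Γ z i l - φ.lag L (z, φ.connCoeff Γ z) := by
  have h := φ.ham_affineHam L Γ (φ.total.map_target hz) P
  rwa [φ.total.right_inv hz] at h

theorem ham_affineHam_contDiffAt {L : Lagrangian π} (hL : IsSmoothLagrangian L)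
    {Γ : ∀ y, Jet π y} (hΓ : IsConnection π Γ) {z : (Fin n → ℝ) × (Fin m → ℝ)}
    (hz : z ∈ φ.total.target) (P : Fin n → Fin m → ℝ) :
    ContDiffAt ℝ ∞ (φ.ham (affineHam L Γ)) (z, P) := by
  have hγ : ∀ i l, ContDiffAt ℝ ∞ (fun a : ((Fin n → ℝ) × (Fin m → ℝ)) × (Fin n → Fin m → ℝ) =>
      φ.connCoeff Γ a.1 i l) (z, P) := fun i l =>
    (φ.connCoeff_contDiffAt hΓ hz i l).comp (z, P) contDiffAt_fst
  have hp : ∀ l i, ContDiffAt ℝ ∞ (fun a : ((Fin n → ℝ) × (Fin m → ℝ)) × (Fin n → Fin m → ℝ) =>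
      a.2 l i) (z, P) := fun l i => by fun_prop
  have h1 : ContDiffAt ℝ ∞ (fun a : ((Fin n → ℝ) × (Fin m → ℝ)) × (Fin n → Fin m → ℝ) =>
      ∑ l, ∑ i, a.2 l i * φ.connCoeff Γ a.1 i l - φ.lag L (a.1, φ.connCoeff Γ a.1)) (z, P) :=
    (ContDiffAt.sum fun l _ => ContDiffAt.sum fun i _ => (hp l i).mul (hγ i l)).sub
      (ContDiffAt.comp (g := φ.lag L) (f := fun a => (a.1, φ.connCoeff Γ a.1)) (z, P)
        (φ.lag_contDiffAt hL hz _) (contDiffAt_fst.prodMk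
        (contDiffAt_pi.2 fun i => contDiffAt_pi.2 fun l => hγ i l)))
  refine h1.congr_of_eventuallyEq ?_
  filter_upwards [(φ.total.open_target.prod isOpen_univ).mem_nhds ⟨hz, Set.mem_univ P⟩] with a ha
  exact φ.ham_affineHam_of_mem L Γ ha.1 a.2

/-- Over a fixed `y`, `ℋ = P·Γ(y) - ℒ(y, Γ(y))` is affine in `P` with slope `Γ(y)`; this is `Ĥ = Γ`.
-/
theorem fderiv_ham_momentum {L : Lagrangian π} (hL : IsSmoothLagrangian L)
    {Γ : ∀ y, Jet π y} (hΓ : IsConnection π Γ) {y : Y} (hy : y ∈ φ.total.source)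
    (P : Fin n → Fin m → ℝ) (i : Fin m) (l : Fin n) :
    fderiv ℝ (φ.ham (affineHam L Γ)) (φ.total y, P) (0, Pi.single l (Pi.single i 1)) =
      φ.jetCoord (Γ y) i l := by
  refine fderiv_apply_of_affine_line
    ((φ.ham_affineHam_contDiffAt hL hΓ (φ.total.map_source hy) P).differentiableAt (by simp))
    fun t => ?_
  rw [Prod.smul_mk, Prod.mk_add_mk, smul_zero, add_zero, φ.ham_affineHam L Γ hy,
    φ.ham_affineHam L Γ hy]
  have h : ∑ k, ∑ j, (t • (Pi.single l (Pi.single i 1) : Fin n → Fin m → ℝ)) k j *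
      φ.jetCoord (Γ y) j k = t * φ.jetCoord (Γ y) i l := by
    rw [Finset.sum_eq_single l, Finset.sum_eq_single i]
    · simp
    · intro j _ hj
      simp [hj]
    · simp
    · intro k _ hk
      simp [hk]
    · simp
  simp only [Pi.add_apply, add_mul, Finset.sum_add_distrib, h]
  ring

/-- On the constraint `P = b(z)`, the derivatives of `ℋ` and `-ℒ` along `Y` agree. -/
theorem fderiv_ham_base {L : Lagrangian π} (hL : IsSmoothLagrangian L)
    {b : (Fin n → ℝ) × (Fin m → ℝ) → Fin n → Fin m → ℝ} {c : (Fin n → ℝ) × (Fin m → ℝ) → ℝ}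
    (hbc : HasAffineExpr L φ b c) {Γ : ∀ y, Jet π y} (hΓ : IsConnection π Γ)
    {z : (Fin n → ℝ) × (Fin m → ℝ)} (hz : z ∈ φ.total.target) (w : (Fin n → ℝ) × (Fin m → ℝ)) :
    fderiv ℝ (φ.ham (affineHam L Γ)) (z, b z) (w, 0) =
      - fderiv ℝ (φ.lag L) (z, φ.connCoeff Γ z) (w, 0) := by
  have hH : HasFDerivAt (fun z' => φ.ham (affineHam L Γ) (z', b z))
      ((fderiv ℝ (φ.ham (affineHam L Γ)) (z, b z)).comp (ContinuousLinearMap.inl ℝ _ _)) z :=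
    HasFDerivAt.comp (g := φ.ham (affineHam L Γ)) (f := fun z' => (z', b z)) z
      ((φ.ham_affineHam_contDiffAt hL hΓ hz (b z)).differentiableAt (by simp)).hasFDerivAt
      (hasFDerivAt_prodMk_left z (b z))
  have hL' : HasFDerivAt (fun z' => φ.lag L (z', φ.connCoeff Γ z))
      ((fderiv ℝ (φ.lag L) (z, φ.connCoeff Γ z)).comp (ContinuousLinearMap.inl ℝ _ _)) z :=
    HasFDerivAt.comp (g := φ.lag L) (f := fun z' => (z', φ.connCoeff Γ z)) z
      ((φ.lag_contDiffAt hL hz _).differentiableAt (by simp)).hasFDerivAt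
      (hasFDerivAt_prodMk_left z _)
  -- Both factors of each summand vanish at `z`, so by the product rule the derivative is zero.
  have hsum : HasFDerivAt (fun z' => ∑ l, ∑ i, (b z l i - b z' l i) *
      (φ.connCoeff Γ z' i l - φ.connCoeff Γ z i l))
      (0 : (Fin n → ℝ) × (Fin m → ℝ) →L[ℝ] ℝ) z := by
    have h0 : (0 : (Fin n → ℝ) × (Fin m → ℝ) →L[ℝ] ℝ) = ∑ l : Fin n, ∑ i : Fin m, 0 := by simp
    rw [h0]
    refine HasFDerivAt.fun_sum fun l _ => HasFDerivAt.fun_sum fun i _ => ?_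
    have hb := (((φ.coeff_contDiffAt hL hbc hz).2 l i).differentiableAt
      (by simp)).hasFDerivAt.const_sub (b z l i)
    have hg := ((φ.connCoeff_contDiffAt hΓ hz i l).differentiableAt
      (by simp)).hasFDerivAt.sub_const (φ.connCoeff Γ z i l)
    have h := hb.fun_mul hg
    simpa using h
  -- Expanding `ℋ(z', b(z)) + ℒ(z', Γ(z))`, the terms in `c` cancel; what remains is the constant
  -- `b(z)Γ(z)` plus the second order product.
  have heq : (fun z' => φ.ham (affineHam L Γ) (z', b z) + φ.lag L (z', φ.connCoeff Γ z))
      =ᶠ[nhds z] fun z' => ∑ l, ∑ i, (b z l i - b z' l i) *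
        (φ.connCoeff Γ z' i l - φ.connCoeff Γ z i l) +
        ∑ l, ∑ i, b z l i * φ.connCoeff Γ z i l := by
    filter_upwards [φ.total.open_target.mem_nhds hz] with z' hz'
    rw [φ.ham_affineHam_of_mem L Γ hz', hbc z' hz', hbc z' hz']
    simp only [sub_mul, mul_sub, Finset.sum_sub_distrib]
    ring
  have h := ((hsum.add_const _).congr_of_eventuallyEq heq).unique (hH.add hL')
  have h' := DFunLike.congr_fun h w
  simp only [zero_apply, add_apply, ContinuousLinearMap.comp_apply,
    ContinuousLinearMap.inl_apply] at h'
  linarith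

end FibredChart

/-! ### The statements of the theorem -/

section MainResults

variable {π : FibredManifold n m X Y}

theorem isHamiltonianForm_affineHam {L : Lagrangian π} (hL : IsSmoothLagrangian L)
    {Γ : ∀ y, Jet π y} (hΓ : IsConnection π Γ) : IsHamiltonianForm (affineHam L Γ) := fun φ =>
  ⟨fun a ha => (φ.ham_affineHam_contDiffAt hL hΓ ha.1 a.2).contDiffWithinAt,
    fun _ hy p => φ.affineHam_eq_hamExpr L Γ hy p⟩

theorem isMomentumMorphismOf_affineHam {L : Lagrangian π} (hL : IsSmoothLagrangian L)
    {Γ : ∀ y, Jet π y} (hΓ : IsConnection π Γ) :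
    IsMomentumMorphismOf (affineHam L Γ) (liftConnection Γ) := fun φ _ hy p i l =>
  (φ.fderiv_ham_momentum hL hΓ hy (φ.momCoord p) i l).symm

theorem FibredChart.ham_affineHam_of_affine (φ : FibredChart π) {L : Lagrangian π}
    {b : (Fin n → ℝ) × (Fin m → ℝ) → Fin n → Fin m → ℝ} {c : (Fin n → ℝ) × (Fin m → ℝ) → ℝ}
    (hbc : HasAffineExpr L φ b c) (Γ : ∀ y, Jet π y) {y : Y} (hy : y ∈ φ.total.source)
    (P : Fin n → Fin m → ℝ) :
    φ.ham (affineHam L Γ) (φ.total y, P) =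
      ∑ l, ∑ i, (P l i - b (φ.total y) l i) * φ.jetCoord (Γ y) i l - c (φ.total y) := by
  rw [φ.ham_affineHam L Γ hy, hbc _ (φ.total.map_source hy)]
  simp only [sub_mul, Finset.sum_sub_distrib]
  ring

theorem jetBundle_mk_eq_iff {y : Y} {ℓ ℓ' : Jet π y} :
    (⟨y, ℓ⟩ : JetBundle π) = ⟨y, ℓ'⟩ ↔ ℓ = ℓ' :=
  ⟨fun h => eq_of_heq (Sigma.mk.inj h).2, fun h => h ▸ rfl⟩

/-- The image of a section of `J¹Y → X` under the Legendre morphism of an affine Lagrangian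
density is a smooth section of `Π → X`. -/
theorem isLegendreSection_legendre {L : Lagrangian π} (hL : IsSmoothLagrangian L)
    (hA : IsAffineLagrangian L) {t : X → JetBundle π} (ht : IsJetSection π t) :
    IsLegendreSection π fun x => ⟨(t x).1, legendre L (t x).2⟩ where
  isSection := ht.isSection
  smooth φ l i := by
    obtain ⟨b, c, hbc⟩ := hA φ
    intro x hx
    have h1 : ContMDiffAt (𝓡 n) 𝓘(ℝ, ℝ) ∞ (fun x => b (φ.total (t x).1) l i) x :=
      ((φ.coeff_contDiffAt hL hbc (φ.total.map_source hx)).2 l i).contMDiffAt.comp x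
        ((φ.total_contMDiffAt hx).comp x (ht.isSection.smooth x))
    refine (h1.congr_of_eventuallyEq ?_).contMDiffWithinAt
    filter_upwards [(φ.total.open_source.preimage ht.isSection.smooth.continuous).mem_nhds hx]
      with x' hx'
    rw [legendre_of_affine φ hbc hx', φ.momCoord_momOf hx']

variable [IsManifold (𝓡 n) ∞ X] [IsManifold (𝓡 (n + m)) ∞ Y]

theorem isAssociated_affineHam {L : Lagrangian π} (hL : IsSmoothLagrangian L)
    (hA : IsAffineLagrangian L) {Γ : ∀ y, Jet π y} (hΓ : IsConnection π Γ) :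
    IsAssociated L (affineHam L Γ) :=
  ⟨isHamiltonianForm_affineHam hL hΓ, liftConnection Γ, isMomentumMorphismOf_affineHam hL hΓ,
    -- The decomposition `H = H_Ĥ + L ∘ Ĥ` is definitional, because `Ĥ` is the lift of `Γ`.
    fun _ _ => legendre_eq_of_affine hA _ _, rfl⟩

theorem hamiltonEqFst_affineHam_iff {L : Lagrangian π} (hL : IsSmoothLagrangian L)
    {Γ : ∀ y, Jet π y} (hΓ : IsConnection π Γ) {r : X → LegendreBundle π}
    (hr : IsLegendreSection π r) :
    HamiltonEqFst (affineHam L Γ) r ↔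
      ∀ x, jetProlongation hr.isSection x = ⟨(r x).1, Γ (r x).1⟩ := by
  have h1 : ∀ x, jetProlongation hr.isSection x = ⟨(r x).1, Γ (r x).1⟩ ↔
      (jetProlongation hr.isSection x).2 = Γ (r x).1 := fun x => jetBundle_mk_eq_iff
  simp only [h1]
  refine ⟨fun h x => ?_, fun h φ x hx i l => ?_⟩
  · obtain ⟨φ, hφ⟩ := π.exists_fibredChart (r x).1
    refine φ.jetCoord_injective hφ (funext fun i => funext fun l => ?_)
    exact (φ.pd_section hr.isSection hφ i l).symm.trans
      ((h φ x hφ i l).trans (φ.fderiv_ham_momentum hL hΓ hφ _ i l))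
  · rw [φ.pd_section hr.isSection hx, φ.fderiv_ham_momentum hL hΓ hx, h x]
    rfl

theorem prolongation_eq_of_eulerLagrange {L : Lagrangian π} {t : X → JetBundle π}
    (ht : IsJetSection π t) (hE : IsEulerLagrangeSolution L t) (x : X) :
    (jetProlongation ht.isSection x).2 = (t x).2 := by
  obtain ⟨φ, hφ⟩ := π.exists_fibredChart (t x).1
  refine φ.jetCoord_injective hφ (funext fun i => funext fun l => ?_)
  exact (φ.pd_section ht.isSection hφ i l).symm.trans ((hE φ x hφ i).1 l)

/-- Along `r = L̂ ∘ t` the momenta are `b^λ_i ∘ s`, so the left side of (b) is the total divergence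
of `b` along `s`. The Euler–Lagrange equations equate it with `∂_i ℒ`, which is `-∂_i ℋ` at `p = b`,
`v = Γ`. -/
theorem hamiltonEqSnd_of_eulerLagrange {L : Lagrangian π} (hL : IsSmoothLagrangian L)
    (hA : IsAffineLagrangian L) {t : X → JetBundle π} (ht : IsJetSection π t)
    (hE : IsEulerLagrangeSolution L t) {Γ : ∀ y, Jet π y} (hΓ : IsConnection π Γ)
    (h : ∀ x, Γ (t x).1 = (t x).2) :
    HamiltonEqSnd (affineHam L Γ) fun x => ⟨(t x).1, legendre L (t x).2⟩ := by
  intro φ x hx i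
  obtain ⟨b, c, hbc⟩ := hA φ
  change (t x).1 ∈ φ.total.source at hx
  have hz := φ.total.map_source hx
  have hP : φ.momCoord (legendre L (t x).2) = b (φ.total (t x).1) := by
    rw [legendre_of_affine φ hbc hx, φ.momCoord_momOf hx]
  have hpd : ∀ l, φ.pd (fun x' => φ.momCoord (legendre L (t x').2) l i) l x =
      fderiv ℝ (fun z => b z l i) (φ.total (t x).1) (Pi.single l 1, 0) +
        ∑ j, φ.jetCoord (t x).2 j l *
          fderiv ℝ (fun z => b z l i) (φ.total (t x).1) (0, Pi.single j 1) := fun l => by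
    -- The chain rule produces the derivatives of the underlying section, so `t` is first replaced
    -- by its prolongation.
    rw [← prolongation_eq_of_eulerLagrange ht hE x]
    refine Eq.trans ?_ (φ.pd_comp_section ht.isSection hx
      (((φ.coeff_contDiffAt hL hbc hz).2 l i).differentiableAt (by simp)) l)
    refine φ.pd_congr (φ.section_mem_base ht.isSection hx) ?_ l
    filter_upwards [(φ.total.open_source.preimage ht.isSection.smooth.continuous).mem_nhds hx]
      with x' hx'
    rw [legendre_of_affine φ hbc hx', φ.momCoord_momOf hx']
  have hel := (hE φ x hx i).2
  simp only [φ.fderiv_lagMomentum_of_affine hL hbc hz, map_zero, mul_zero,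
    Finset.sum_const_zero, add_zero] at hel
  have hham := φ.fderiv_ham_base hL hbc hΓ hz (0, Pi.single i 1)
  rw [φ.connCoeff_total Γ hx, h x] at hham
  simp only [hpd, hP, hham, neg_neg]
  exact (sub_eq_zero.1 hel).symm

/-- Choose `Γ` through the section underlying `t`. Then `Γ ∘ s = J¹s = t`, the last equality being
the first Euler–Lagrange equation. -/
theorem isCompleteFamily_affineHam [T2Space Y] [SecondCountableTopology Y] {L : Lagrangian π}
    (hL : IsSmoothLagrangian L) (hA : IsAffineLagrangian L) :
    IsCompleteFamily L {H | ∃ Γ : ∀ y, Jet π y, IsConnection π Γ ∧ H = affineHam L Γ} := by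
  refine ⟨isSemiregular_of_affine hA, ?_, fun t ht hE => ?_⟩
  · rintro _ ⟨Γ, hΓ, rfl⟩
    exact isAssociated_affineHam hL hA hΓ
  obtain ⟨Γ, hΓ, hs⟩ := exists_connection ht.isSection
  have hJ := prolongation_eq_of_eulerLagrange ht hE
  have hΓt : ∀ x, Γ (t x).1 = (t x).2 := fun x => (hs x).trans (hJ x)
  have hr := isLegendreSection_legendre hL hA ht
  refine ⟨_, ⟨Γ, hΓ, rfl⟩, _, hr, ?_, hamiltonEqSnd_of_eulerLagrange hL hA ht hE hΓ hΓt,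
    fun _ => rfl, ⟨liftConnection Γ, isMomentumMorphismOf_affineHam hL hΓ, fun x => ?_⟩,
    fun x => ?_⟩
  · exact (hamiltonEqFst_affineHam_iff hL hΓ hr).2 fun x => jetBundle_mk_eq_iff.2 (hs x).symm
  · exact (jetBundle_mk_eq_iff (ℓ := (t x).2)).2 (hΓt x).symm
  · exact (jetBundle_mk_eq_iff (ℓ := (t x).2)).2 (hJ x).symm

end MainResults

end

theorem mainTheorem4 {n m : ℕ} {X Y : Type*}
    [TopologicalSpace X] [T2Space X] [SecondCountableTopology X]
    [ChartedSpace (EuclideanSpace ℝ (Fin n)) X] [IsManifold (𝓡 n) ∞ X]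
    [TopologicalSpace Y] [T2Space Y] [SecondCountableTopology Y]
    [ChartedSpace (EuclideanSpace ℝ (Fin (n + m))) Y] [IsManifold (𝓡 (n + m)) ∞ Y]
    (π : FibredManifold n m X Y) (L : Lagrangian π)
    (hL : IsSmoothLagrangian L) (hA : IsAffineLagrangian L) :
    (∀ Γ : ∀ y, Jet π y, IsConnection π Γ →
      -- the form is Hamiltonian, with the stated coordinate expression, and associated with `L`
      IsHamiltonianForm (affineHam L Γ) ∧
      (∀ (φ : FibredChart π) b c, HasAffineExpr L φ b c →
        ∀ y ∈ φ.total.source, ∀ P : Fin n → Fin m → ℝ,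
          φ.ham (affineHam L Γ) (φ.total y, P) =
            ∑ l, ∑ i, (P l i - b (φ.total y) l i) * φ.jetCoord (Γ y) i l - c (φ.total y)) ∧
      IsAssociated L (affineHam L Γ) ∧
      IsMomentumMorphismOf (affineHam L Γ) (liftConnection Γ) ∧
      -- the first group of Hamilton equations is the gauge-type condition `J¹s = Γ ∘ s`
      (∀ (r : X → LegendreBundle π) (hr : IsLegendreSection π r),
        HamiltonEqFst (affineHam L Γ) r ↔
          ∀ x, jetProlongation hr.isSection x = ⟨(r x).1, Γ (r x).1⟩)) ∧
    -- every section `s` is an integral section of some connection `Γ`, and then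
    -- `Ĥ ∘ L̂ ∘ J¹s = J¹s`
    (∀ (s : X → Y) (hs : IsSection π s), ∃ Γ : ∀ y, Jet π y, IsConnection π Γ ∧
      (∀ x, jetProlongation hs x = ⟨s x, Γ (s x)⟩) ∧
      ∃ Φ : MomentumMorphism π, IsMomentumMorphismOf (affineHam L Γ) Φ ∧
        ∀ x, (⟨s x, Φ (s x) (legendre L (jetProlongation hs x).2)⟩ : JetBundle π) =
          jetProlongation hs x) ∧
    IsCompleteFamily L {H | ∃ Γ : ∀ y, Jet π y, IsConnection π Γ ∧ H = affineHam L Γ} := by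
  refine ⟨fun Γ hΓ => ⟨isHamiltonianForm_affineHam hL hΓ,
    fun φ b c hbc y hy P => φ.ham_affineHam_of_affine hbc Γ hy P,
    isAssociated_affineHam hL hA hΓ, isMomentumMorphismOf_affineHam hL hΓ,
    fun r hr => hamiltonEqFst_affineHam_iff hL hΓ hr⟩, fun s hs => ?_,
    isCompleteFamily_affineHam hL hA⟩
  obtain ⟨Γ, hΓ, hsec⟩ := exists_connection hs
  -- Here `Ĥ` ignores the momentum, so `Ĥ ∘ L̂ ∘ J¹s` is just `Γ ∘ s`.
  exact ⟨Γ, hΓ, fun x => jetBundle_mk_eq_iff.2 (hsec x).symm, liftConnection Γ,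
    isMomentumMorphismOf_affineHam hL hΓ, fun x => jetBundle_mk_eq_iff.2 (hsec x)⟩
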